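/- **Setting.** Consider a well-typed (monomorphic) Mercury program in superhomogeneous form. Its procedures $p(x_1,\dots,x_n)\leftarrow G$ have input and output arguments. Its goals are built from assignments $x:=y$, constructions $x\Leftarrow f(y_1,\dots,y_n)$, deconstructions $x\Rightarrow f(y_1,\dots,y_n)$, tests $x==y$ and calls $q(y_1,\dots,y_n)$, by conjunction, disjunction, if-then-else and existential quantification. Every construction allocates a new heap cell that holds $f$ and pointers to its arguments. A region points-to graph $G_p=(N_p,E_p)$ for a procedure $p$ has nodes (region variables), sets $\mathit{vars}(n)$ of variables for $n\in N_p$, and edges $(n,(f,i),m)$. The node whose set contains $x$ is the location $n_x$ of $x$. For a position $\pi$, a sequence of labels $(f,i)$, let $n_x.\pi$ be the node reached from $n_x$ along $\pi$. Two variables *region-share* in $G_p$ if some node is reachable from both of their locations. The region points-to analysis works as follows. Unifying two nodes merges them, and then repeatedly unifies any two children of the merged node that carry the same label. * *Intraprocedural part.* Start from the disjoint union, over the variables $x$ of $p$, of the graphs of their types: one node per type occurring in terms of the type of $x$, an edge $(f,i)$ from $t$ to $t_i$ for each alternative $f(t_1,\dots,t_n)$ of $t$, and $x$ placed in the principal node.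 Unify $n_x,n_y$ for each assignment $x:=y$; unify the $(f,i)$-child of $n_x$ with $n_{y_i}$ for each construction or deconstruction. * *Interprocedural part.* At a call $q(y_1,\dots,y_n)$ in $p$ with formal arguments $x_1,\dots,x_n$, relate each $n_{x_k}$ in $G_q$ to $n_{y_k}$ in $G_p$ by $\alpha$, and unify nodes of $G_p$ until $\alpha$ is a function. Then follow the edges of $G_q$ from the formal arguments: for $(n,(f,i),m)\in E_q$ and $(\alpha(n),(f,i),k)\in E_p$, set $\alpha(m)=k$ if $\alpha(m)$ is undefined, and unify $k$ with $\alpha(m)$ otherwise. Repeat this for the call sites of $p$ until neither $G_p$ nor any $\alpha$ changes. Do it for the procedures of each strongly connected component of the call graph until a fixpoint is reached, taking the components bottom-up. **Theorem.** Let $(G_p)_p$ be the graphs that result from the region points-to analysis of the program. Then: 1. In $G_p$ every variable of $p$ has exactly one location, and no node has two out-edges with the same label. 2. (Explicit unifications) If $x:=y$ occurs in $p$, then $n_x=n_y$ in $G_p$. If $x\Leftarrow f(y_1,\dots,y_n)$ or $x\Rightarrow f(y_1,\dots,y_n)$ occurs in $p$, then $(n_x,(f,i),n_{y_i})\in E_p$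 for all $i$. 3. (Procedure calls, including recursive ones) If $q(y_1,\dots,y_n)$ is called in $p$ and $x_1,\dots,x_n$ are the formal arguments of $q$, then there is a map $\alpha$ with $\alpha(n_{x_k})=n_{y_k}$ for all $k$, such that $(\alpha(n),(f,i),\alpha(m))\in E_p$ for every edge $(n,(f,i),m)\in E_q$ whose source is reachable from some $n_{x_k}$. Consequently, if $x_i,x_j$ region-share in $G_q$, then $y_i,y_j$ region-share in $G_p$. 4. Consider any moment of any execution (by depth-first search with backtracking) that starts with a call of some procedure on well-typed ground input terms, and any activation of a procedure $p$ on the call stack at that moment. * (Locations) If $x$ is bound to a term with a subterm at position $\pi$, then there is exactly one node $n_x.\pi$ in $G_p$. * (Sharing) If the subterm of $x$ at position $\pi$ and the subterm of $y$ at position $\rho$ are the same heap cell $c$, then $n_x.\pi=n_y.\rho$, so that $x,y$ region-share in $G_p$. The only exception is sharing that was handed in by the caller: $c$ already existed when the activation was entered, and there are two different input arguments $x_0\ne y_0$ of $p$ whose terms contain $c$, at positions $\pi_0,\rho_0$ with $n_{x_0}.\pi_0=n_x.\pi$ and $n_{y_0}.\rho_0=n_y.\rho$ (so that $x$ region-shares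 with $x_0$ and $y$ with $y_0$ in $G_p$). 5. In such an execution, each activation of $q$ other than the first was started by a call site $q(y_1,\dots,y_n)$ of the activation below it, and each of its input arguments $x_k$ is bound to the same cell as the caller's variable $y_k$. Hence sharing that was handed in is sharing among the caller's variables, to which 4 applies. -/

import Mathlib

namespace Mercury

/-! ### Programs in superhomogeneous form

`V` are program variables, `T` types, `F` function symbols, `Pr` procedures.  Types are monomorphic and
every term, constants included, occupies a memory cell.  Argument positions are counted from `0`. -/

/-- Argument modes of a procedure. -/
inductive Mode
  | input
  | output

/-- Mode-annotated unifications: `x := y`, `x <= f(ys)`, `x => f(ys)`, `x == y`. -/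
inductive Unif (V F : Type*)
  | assign (x y : V)
  | construct (x : V) (f : F) (ys : List V)
  | deconstruct (x : V) (f : F) (ys : List V)
  | test (x y : V)

/-- Goals.  Conjunctions and disjunctions of `n` goals are nested binary ones, with `succeed` and `fail`
as the empty ones.  The flag of `quant` tells whether the existential quantification is a commit. -/
inductive Goal (V F Pr : Type*)
  | unif (u : Unif V F)
  | call (q : Pr) (ys : List V)
  | succeed
  | fail
  | conj (g₁ g₂ : Goal V F Pr)
  | disj (g₁ g₂ : Goal V F Pr)
  | ite (c t e : Goal V F Pr)
  | quant (commit : Bool) (xs : List V) (g : Goal V F Pr)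

/-- Negation, as an if-then-else. -/
def Goal.neg {V F Pr : Type*} (g : Goal V F Pr) : Goal V F Pr := .ite g .fail .succeed

/-- The variables of a unification. -/
def Unif.vars {V F : Type*} : Unif V F → Set V
  | .assign x y => {x, y}
  | .construct x _ ys => {x} ∪ {y | y ∈ ys}
  | .deconstruct x _ ys => {x} ∪ {y | y ∈ ys}
  | .test x y => {x, y}

namespace Goal

variable {V F Pr : Type*}

/-- The variables of a goal. -/
def vars : Goal V F Pr → Set V
  | .unif u => u.vars
  | .call _ ys => {y | y ∈ ys}
  | .succeed => ∅
  | .fail => ∅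
  | .conj g₁ g₂ => g₁.vars ∪ g₂.vars
  | .disj g₁ g₂ => g₁.vars ∪ g₂.vars
  | .ite c t e => c.vars ∪ t.vars ∪ e.vars
  | .quant _ xs g => {x | x ∈ xs} ∪ g.vars

/-- The unifications that occur in a goal. -/
def unifs : Goal V F Pr → List (Unif V F)
  | .unif u => [u]
  | .call _ _ => []
  | .succeed => []
  | .fail => []
  | .conj g₁ g₂ => g₁.unifs ++ g₂.unifs
  | .disj g₁ g₂ => g₁.unifs ++ g₂.unifs
  | .ite c t e => c.unifs ++ t.unifs ++ e.unifs
  | .quant _ _ g => g.unifs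

/-- The call sites of a goal: callee and actual arguments. -/
def calls : Goal V F Pr → List (Pr × List V)
  | .unif _ => []
  | .call q ys => [(q, ys)]
  | .succeed => []
  | .fail => []
  | .conj g₁ g₂ => g₁.calls ++ g₂.calls
  | .disj g₁ g₂ => g₁.calls ++ g₂.calls
  | .ite c t e => c.calls ++ t.calls ++ e.calls
  | .quant _ _ g => g.calls

end Goal

/-- A program.  `sig t f = some [t₁, …, tₙ]` says that the definition of the type `t` has the alternative
`f(t₁, …, tₙ)`. -/
structure Program (V T F Pr : Type*) where
  sig : T → F → Option (List T)
  head : Pr → List (V × Mode)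
  body : Pr → Goal V F Pr
  varType : Pr → V → T

section ProgramBasics

variable {V T F Pr : Type*}

/-- The formal arguments of a procedure. -/
def Program.formals (P : Program V T F Pr) (p : Pr) : List V := (P.head p).map Prod.fst

/-- The variables of a procedure. -/
def Program.vars (P : Program V T F Pr) (p : Pr) : Set V := {x | x ∈ P.formals p} ∪ (P.body p).vars

/-- Well-typed unifications in superhomogeneous form. -/
def Program.UnifOK (P : Program V T F Pr) (p : Pr) : Unif V F → Prop
  | .assign x y => P.varType p x = P.varType p y
  | .construct x f ys => ys.Nodup ∧ P.sig (P.varType p x) f = some (ys.map (P.varType p))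
  | .deconstruct x f ys => ys.Nodup ∧ P.sig (P.varType p x) f = some (ys.map (P.varType p))
  | .test x y => P.varType p x = P.varType p y

/-- Well-typed programs in superhomogeneous form. -/
structure Program.WellFormed (P : Program V T F Pr) : Prop where
  formals_nodup : ∀ p, (P.formals p).Nodup
  unifs_ok : ∀ p, ∀ u ∈ (P.body p).unifs, P.UnifOK p u
  calls_ok : ∀ p q ys, (q, ys) ∈ (P.body p).calls →
    ys.Nodup ∧ ys.map (P.varType p) = (P.formals q).map (P.varType q)

/-- `p` calls `q`: the call-dependency graph. -/
def Program.Calls (P : Program V T F Pr) (p q : Pr) : Prop := ∃ ys, (q, ys) ∈ (P.body p).calls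

end ProgramBasics

/-! ### Region points-to graphs -/

/-- Region variables.  `(x, t)` is the one generated for the type `t` in the type-based region graph of
(the type of) the variable `x`, so that different variables have different region variables. -/
abbrev Node (V T : Type*) := V × T

/-- Edge labels `(f, i)`. -/
abbrev Label (F : Type*) := F × ℕ

/-- Region points-to graphs. -/
structure RPTG (V T F : Type*) where
  nodes : Set (Node V T)
  vars : Node V T → Set V
  edges : Set (Node V T × Label F × Node V T)

namespace RPTG

variable {V T F : Type*}

/-- `n` is the location of `x`. -/
def Loc (G : RPTG V T F) (x : V) (n : Node V T) : Prop := n ∈ G.nodes ∧ x ∈ G.vars n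

/-- Following the edges with the given labels leads from the first node to the second one. -/
def Path (G : RPTG V T F) : Node V T → List (Label F) → Node V T → Prop
  | n, [], m => n = m
  | n, l :: π, m => ∃ k, (n, l, k) ∈ G.edges ∧ G.Path k π m

/-- Reachability along edges. -/
def Reach (G : RPTG V T F) : Node V T → Node V T → Prop :=
  Relation.ReflTransGen fun n m => ∃ l, (n, l, m) ∈ G.edges

/-- Two variables region-share if some node can be reached from the locations of both. -/
def RegionShare (G : RPTG V T F) (x y : V) : Prop :=
  ∃ n m k, G.Loc x n ∧ G.Loc y m ∧ G.Reach n k ∧ G.Reach m k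

/-- `m` is the node for the subterm at the position `π` of (the term bound to) `x`. -/
def NodeAt (G : RPTG V T F) (x : V) (π : List (Label F)) (m : Node V T) : Prop :=
  ∃ n, G.Loc x n ∧ G.Path n π m

open Classical in
/-- Replaces `m` by `n`. -/
noncomputable def redirect (n m : Node V T) (k : Node V T) : Node V T := if k = m then n else k

/-- The node `m` is removed, its variables and its in- and out-edges are given to `n`. -/
def merge (G : RPTG V T F) (n m : Node V T) : RPTG V T F where
  nodes := G.nodes \ {m}
  vars := fun k => {x | ∃ k', redirect n m k' = k ∧ x ∈ G.vars k'}
  edges := {e | ∃ e' ∈ G.edges, e = (redirect n m e'.1, e'.2.1, redirect n m e'.2.2)}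

/-- The last loop of `unify`: as long as `n` has out-edges with the same label to two different nodes, unify
these nodes.  The function `ρ` sends every node to the node that it has been merged into. -/
inductive UnifyChildren :
    RPTG V T F → Node V T → (Node V T → Node V T) → RPTG V T F → Prop
  | done (G : RPTG V T F) (n : Node V T)
      (h : ∀ l m m', (n, l, m) ∈ G.edges → (n, l, m') ∈ G.edges → m = m') :
      UnifyChildren G n id G
  | next (G G₁ G₂ : RPTG V T F) (n m m' : Node V T) (l : Label F) (ρ₁ ρ₂ : Node V T → Node V T)
      (hm : (n, l, m) ∈ G.edges) (hm' : (n, l, m') ∈ G.edges) (hne : m ≠ m')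
      (h₁ : UnifyChildren (G.merge m m') m ρ₁ G₁)
      (h₂ : UnifyChildren G₁ n ρ₂ G₂) :
      UnifyChildren G n (ρ₂ ∘ ρ₁ ∘ redirect m m') G₂

/-- `unify(n, m)` turns `G` into `G'`; nothing happens if `n` and `m` are the same node already. -/
def Unify (G : RPTG V T F) (n m : Node V T) (ρ : Node V T → Node V T) (G' : RPTG V T F) : Prop :=
  (n = m ∧ ρ = id ∧ G' = G) ∨
  (n ≠ m ∧ ∃ ρ', UnifyChildren (G.merge n m) n ρ' G' ∧ ρ = ρ' ∘ redirect n m)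

end RPTG

/-! ### Control structure of the algorithms -/

/-- Runs the nondeterministic commands `R i` for the entries `i` of a list, one after the other. -/
inductive RunList {ι S : Type*} (R : ι → S → S → Prop) : List ι → S → S → Prop
  | nil (s : S) : RunList R [] s s
  | cons (i : ι) (is : List ι) (s t u : S) (h : R i s t) (hs : RunList R is t u) :
      RunList R (i :: is) s u

/-- `repeat R until there is no change`. -/
inductive RepeatUntilStable {S : Type*} (R : S → S → Prop) : S → S → Prop
  | stable (s : S) (h : R s s) : RepeatUntilStable R s s
  | again (s t u : S) (h : R s t) (hne : t ≠ s) (hs : RepeatUntilStable R t u) : RepeatUntilStable R s u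

/-! ### Intraprocedural analysis -/

section Intra

variable {V T F Pr : Type*}

/-- `t'` is an argument type of an alternative of `t`. -/
def Program.ArgType (P : Program V T F Pr) (t t' : T) : Prop := ∃ f ts, P.sig t f = some ts ∧ t' ∈ ts

/-- Nodes of the type-based region graph of `t`, one for each type that occurs in terms of type `t`. -/
def Program.typeNodes (P : Program V T F Pr) (t : T) : Set T := {t' | Relation.ReflTransGen P.ArgType t t'}

/-- Edges of the type-based region graph of `t`. -/
def Program.typeEdges (P : Program V T F Pr) (t : T) : Set (T × Label F × T) :=
  {e | e.1 ∈ P.typeNodes t ∧ ∃ ts, P.sig e.1 e.2.1.1 = some ts ∧ ts[e.2.1.2]? = some e.2.2}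

/-- The initial region points-to graph of a variable: a fresh copy of the graph of its type, with the
variable placed in the principal node. -/
def Program.initVar (P : Program V T F Pr) (p : Pr) (x : V) : RPTG V T F where
  nodes := {n | n.1 = x ∧ n.2 ∈ P.typeNodes (P.varType p x)}
  vars := fun n => {y | y = x ∧ n = (x, P.varType p x)}
  edges := {e | e.1.1 = x ∧ e.2.2.1 = x ∧ (e.1.2, e.2.1, e.2.2.2) ∈ P.typeEdges (P.varType p x)}

/-- The (disjoint) union of the initial graphs of the variables of a procedure. -/
def Program.initGraph (P : Program V T F Pr) (p : Pr) : RPTG V T F where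
  nodes := {n | ∃ x ∈ P.vars p, n ∈ (P.initVar p x).nodes}
  vars := fun n => {y | ∃ x ∈ P.vars p, y ∈ (P.initVar p x).vars n}
  edges := {e | ∃ x ∈ P.vars p, e ∈ (P.initVar p x).edges}

/-- For each `(i, y)` in the list in turn, `unify(node(n_x, (f, i)), n_y)`. -/
def UnifyArgs (x : V) (f : F) : List (V × ℕ) → RPTG V T F → RPTG V T F → Prop :=
  RunList fun yi G G' =>
    ∃ n k m ρ, G.Loc x n ∧ (n, (f, yi.2), k) ∈ G.edges ∧ G.Loc yi.1 m ∧ G.Unify k m ρ G'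

/-- The intraprocedural treatment of one unification. -/
def IntraUnif : Unif V F → RPTG V T F → RPTG V T F → Prop
  | .assign x y, G, G' => ∃ n m ρ, G.Loc x n ∧ G.Loc y m ∧ G.Unify n m ρ G'
  | .construct x f ys, G, G' => UnifyArgs x f ys.zipIdx G G'
  | .deconstruct x f ys, G, G' => UnifyArgs x f ys.zipIdx G G'
  | .test _ _, G, G' => G' = G

/-- `G` is a possible result of the intraprocedural analysis of `p`, which takes the unifications of `p` in
any order. -/
def Program.Intraproc (P : Program V T F Pr) (p : Pr) (G : RPTG V T F) : Prop :=
  ∃ us, us.Perm (P.body p).unifs ∧ RunList IntraUnif us (P.initGraph p) G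

end Intra

/-! ### Interprocedural analysis -/

section Inter

variable {V T F Pr : Type*}

/-- The relation `α` between nodes of the callee and nodes of the caller, as a set of pairs. -/
abbrev Alpha (V T : Type*) := Set (Node V T × Node V T)

/-- Follows the merging of nodes of the caller. -/
def Alpha.rename (α : Alpha V T) (ρ : Node V T → Node V T) : Alpha V T :=
  {e | ∃ e' ∈ α, e = (e'.1, ρ e'.2)}

/-- The connection of the formal arguments `xs` in `Gq` with the actual arguments `ys` in `Gp`. -/
def Alpha.init (Gq Gp : RPTG V T F) (xs ys : List V) : Alpha V T :=
  {e | ∃ (k : ℕ) (x y : V), xs[k]? = some x ∧ ys[k]? = some y ∧ Gq.Loc x e.1 ∧ Gp.Loc y e.2}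

/-- Makes `α` a function, by unifying nodes of the caller. -/
inductive EnsureFun : RPTG V T F × Alpha V T → RPTG V T F × Alpha V T → Prop
  | done (G : RPTG V T F) (α : Alpha V T)
      (h : ∀ n m m', (n, m) ∈ α → (n, m') ∈ α → m = m') : EnsureFun (G, α) (G, α)
  | next (G G' : RPTG V T F) (α : Alpha V T) (n m m' : Node V T) (ρ : Node V T → Node V T)
      (r : RPTG V T F × Alpha V T)
      (hm : (n, m) ∈ α) (hm' : (n, m') ∈ α) (hne : m ≠ m') (hu : G.Unify m m' ρ G')
      (hr : EnsureFun (G', α.rename ρ) r) : EnsureFun (G, α) r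

/-- One application of the rule P1 or of the rule P2 to the edge `(nq, l, mq)` of the callee's graph `Gq`. -/
inductive Rule (Gq : RPTG V T F) : RPTG V T F × Alpha V T → RPTG V T F × Alpha V T → Prop
  | P1 (G G' : RPTG V T F) (α : Alpha V T) (nq mq np mp mp' : Node V T) (l : Label F)
      (ρ : Node V T → Node V T)
      (hq : (nq, l, mq) ∈ Gq.edges) (hα : (nq, np) ∈ α) (hp : (np, l, mp) ∈ G.edges)
      (hα' : (mq, mp') ∈ α) (hne : mp' ≠ mp) (hu : G.Unify mp mp' ρ G') :
      Rule Gq (G, α) (G', α.rename ρ)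
  | P2 (G : RPTG V T F) (α : Alpha V T) (nq mq np mp : Node V T) (l : Label F)
      (hq : (nq, l, mq) ∈ Gq.edges) (hα : (nq, np) ∈ α) (hp : (np, l, mp) ∈ G.edges)
      (hα' : ∀ k, (mq, k) ∉ α) :
      Rule Gq (G, α) (G, insert (mq, mp) α)

/-- The conditions under which P1 or P2 can be applied. -/
def Applicable (Gq G : RPTG V T F) (α : Alpha V T) : Prop :=
  ∃ nq mq np mp l, (nq, l, mq) ∈ Gq.edges ∧ (nq, np) ∈ α ∧ (np, l, mp) ∈ G.edges ∧
    ((∃ mp', (mq, mp') ∈ α ∧ mp' ≠ mp) ∨ ∀ k, (mq, k) ∉ α)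

/-- The traversal of the callee's graph from the formal arguments: the rules are applied, in any order (in
particular, in the order of a depth-first traversal), until none can be applied. -/
def Integrate (Gq : RPTG V T F) (r r' : RPTG V T F × Alpha V T) : Prop :=
  Relation.ReflTransGen (Rule Gq) r r' ∧ ¬ Applicable Gq r'.1 r'.2

/-- The processing of one call site.  `Gq` is the callee's graph when the processing starts. -/
def CallSite (Gq Gp : RPTG V T F) (xs ys : List V) (r : RPTG V T F × Alpha V T) : Prop :=
  ∃ r₁, EnsureFun (Gp, Alpha.init Gq Gp xs ys) r₁ ∧ Integrate Gq r₁ r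

/-- State of the analysis of a procedure: all graphs, and the `α` of each of its call sites. -/
abbrev InterState (V T F Pr : Type*) := (Pr → RPTG V T F) × (ℕ → Alpha V T)

open Classical in
/-- The processing of the `k`-th call site of `p`. -/
def Program.ProcessCall (P : Program V T F Pr) (p : Pr) (k : ℕ) (s s' : InterState V T F Pr) : Prop :=
  ∃ q ys G α, (P.body p).calls[k]? = some (q, ys) ∧ CallSite (s.1 q) (s.1 p) (P.formals q) ys (G, α) ∧
    s' = (Function.update s.1 p G, Function.update s.2 k α)

/-- One pass over all call sites of `p`, in any order. -/
def Program.InterPass (P : Program V T F Pr) (p : Pr) (s s' : InterState V T F Pr) : Prop :=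
  ∃ ks, ks.Perm (List.range (P.body p).calls.length) ∧ RunList (P.ProcessCall p) ks s s'

/-- The interprocedural analysis of `p` can turn the graphs `Γ` into `Γ'`. -/
def Program.Interproc (P : Program V T F Pr) (p : Pr) (Γ Γ' : Pr → RPTG V T F) : Prop :=
  ∃ A, RepeatUntilStable (P.InterPass p) (Γ, fun _ => ∅) (Γ', A)

/-- `L` lists the strongly connected components of the call-dependency graph in bottom-up order. -/
structure Program.BottomUpSCCs (P : Program V T F Pr) (L : List (List Pr)) : Prop where
  nodup : L.flatten.Nodup
  complete : ∀ p, p ∈ L.flatten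
  nonempty : ∀ C ∈ L, C ≠ []
  scc : ∀ C ∈ L, ∀ p ∈ C, ∀ q,
    q ∈ C ↔ Relation.ReflTransGen P.Calls p q ∧ Relation.ReflTransGen P.Calls q p
  order : L.Pairwise fun C D => ∀ p ∈ C, ∀ q ∈ D, ¬ P.Calls p q

/-- `Γ` is a possible result of the region points-to analysis of the program. -/
def Program.Analysis (P : Program V T F Pr) (Γ : Pr → RPTG V T F) : Prop :=
  ∃ Γ₀ L, (∀ p, P.Intraproc p (Γ₀ p)) ∧ P.BottomUpSCCs L ∧
    RunList (fun C => RepeatUntilStable (RunList P.Interproc C)) L Γ₀ Γ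

end Inter

/-! ### Execution

A backtracking machine.  Unifications and calls that are not executed in accordance with their modes (use of
an unbound variable, binding of a bound one) have no transition. -/

/-- A memory cell: a function symbol and the addresses of the arguments. -/
structure Cell (F : Type*) where
  fn : F
  args : List ℕ

/-- The cell at address `a` is the `a`-th entry. -/
abbrev Heap (F : Type*) := List (Cell F)

/-- Variable bindings of an activation: addresses of the principal cells. -/
abbrev Env (V : Type*) := V → Option ℕ

/-- The addresses `a` and `b` hold the same ground term. -/
inductive SameTerm {F : Type*} (h : Heap F) : ℕ → ℕ → Prop
  | mk (a b : ℕ) (c d : Cell F) (ha : h[a]? = some c) (hb : h[b]? = some d) (hfn : c.fn = d.fn)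
      (hlen : c.args.length = d.args.length)
      (hargs : ∀ (i a' b' : ℕ), c.args[i]? = some a' → d.args[i]? = some b' → SameTerm h a' b') :
      SameTerm h a b

/-- What remains to be executed in an activation: goals, and the ends of conditions and of commits, which
remember the height of the choice point stack at the time of entry. -/
inductive Instr (V F Pr : Type*)
  | goal (g : Goal V F Pr)
  | endCond (d : ℕ)
  | endCommit (d : ℕ)

/-- An activation of a procedure.  `base` is the size of the heap at the time of the call: the cells at
addresses `≥ base` have been allocated since.  `ret` are the caller's actual arguments. -/
structure Frame (V F Pr : Type*) where
  proc : Pr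
  env : Env V
  base : ℕ
  cont : List (Instr V F Pr)
  ret : List V

/-- Machine states.  The active procedure call is the first entry of `stack`.  `choices` is the stack of choice
points, each holding the computation to be resumed; `none` is a choice point that has been disabled. -/
structure State (V F Pr : Type*) where
  stack : List (Frame V F Pr)
  heap : Heap F
  choices : List (Option (List (Frame V F Pr) × Heap F))

section Exec

variable {V T F Pr : Type*}

open Classical in
/-- Binds the variables of a list to the addresses of a list. -/
noncomputable def Env.bindAll (σ : Env V) : List V → List ℕ → Env V
  | y :: ys, a :: as => Function.update (Env.bindAll σ ys as) y (some a)
  | _, _ => σ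

open Classical in
/-- The callee's bindings at entry, from the caller's bindings `σ`: input arguments are bound. -/
noncomputable def enterEnv (σ : Env V) : List (V × Mode) → List V → Env V
  | (x, .input) :: hs, y :: ys => Function.update (enterEnv σ hs ys) x (σ y)
  | (_, .output) :: hs, _ :: ys => enterEnv σ hs ys
  | _, _ => fun _ => none

open Classical in
/-- The caller's bindings after the return, from its bindings `σ` and the callee's bindings `σ'`: output
arguments are bound. -/
noncomputable def exitEnv (σ' σ : Env V) : List (V × Mode) → List V → Env V
  | (x, .output) :: hs, y :: ys => Function.update (exitEnv σ' σ hs ys) y (σ' x)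
  | (_, .input) :: hs, _ :: ys => exitEnv σ' σ hs ys
  | _, _ => σ

/-- The call complies with the modes: input arguments are bound, output arguments are free. -/
def CallModesOK (σ : Env V) (hs : List (V × Mode)) (ys : List V) : Prop :=
  ∀ x m y, ((x, m), y) ∈ hs.zip ys →
    match m with
    | .input => σ y ≠ none
    | .output => σ y = none

/-- Backtracking: the most recent choice point that is not disabled is resumed. -/
inductive Resume : List (Option (List (Frame V F Pr) × Heap F)) → State V F Pr → Prop
  | here (st : List (Frame V F Pr)) (h : Heap F) (cps : List (Option (List (Frame V F Pr) × Heap F))) :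
      Resume (some (st, h) :: cps) ⟨st, h, cps⟩
  | skip (cps : List (Option (List (Frame V F Pr) × Heap F))) (s : State V F Pr) (hr : Resume cps s) :
      Resume (none :: cps) s

/-- A unification that succeeds: new bindings and heap. -/
inductive UnifSucceeds : Unif V F → Env V → Heap F → Env V → Heap F → Prop
  | assign (x y : V) (σ : Env V) (h : Heap F) (a : ℕ) (hx : σ x = none) (hy : σ y = some a) :
      UnifSucceeds (.assign x y) σ h (σ.bindAll [x] [a]) h
  | construct (x : V) (f : F) (ys : List V) (σ : Env V) (h : Heap F) (as : List ℕ) (hx : σ x = none)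
      (hys : ys.map σ = as.map some) :
      UnifSucceeds (.construct x f ys) σ h (σ.bindAll [x] [h.length]) (h ++ [⟨f, as⟩])
  | deconstruct (x : V) (f : F) (ys : List V) (σ : Env V) (h : Heap F) (a : ℕ) (as : List ℕ)
      (hx : σ x = some a) (ha : h[a]? = some ⟨f, as⟩) (hlen : as.length = ys.length)
      (hys : ∀ y ∈ ys, σ y = none) :
      UnifSucceeds (.deconstruct x f ys) σ h (σ.bindAll ys as) h
  | test (x y : V) (σ : Env V) (h : Heap F) (a b : ℕ) (hx : σ x = some a) (hy : σ y = some b)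
      (hab : SameTerm h a b) :
      UnifSucceeds (.test x y) σ h σ h

/-- A unification that fails. -/
inductive UnifFails : Unif V F → Env V → Heap F → Prop
  | deconstruct (x : V) (f : F) (ys : List V) (σ : Env V) (h : Heap F) (a : ℕ) (c : Cell F)
      (hx : σ x = some a) (ha : h[a]? = some c) (hne : ¬ (c.fn = f ∧ c.args.length = ys.length)) :
      UnifFails (.deconstruct x f ys) σ h
  | test (x y : V) (σ : Env V) (h : Heap F) (a b : ℕ) (hx : σ x = some a) (hy : σ y = some b)
      (hab : ¬ SameTerm h a b) :
      UnifFails (.test x y) σ h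

/-- The transitions of the machine. -/
inductive Program.Step (P : Program V T F Pr) : State V F Pr → State V F Pr → Prop
  | unif (u : Unif V F) (p : Pr) (σ σ' : Env V) (b : ℕ) (K : List (Instr V F Pr)) (ret : List V)
      (st : List (Frame V F Pr)) (h h' : Heap F) (cps : List (Option (List (Frame V F Pr) × Heap F)))
      (hu : UnifSucceeds u σ h σ' h') :
      P.Step ⟨⟨p, σ, b, .goal (.unif u) :: K, ret⟩ :: st, h, cps⟩ ⟨⟨p, σ', b, K, ret⟩ :: st, h', cps⟩
  | unifFail (u : Unif V F) (p : Pr) (σ : Env V) (b : ℕ) (K : List (Instr V F Pr)) (ret : List V)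
      (st : List (Frame V F Pr)) (h : Heap F) (cps : List (Option (List (Frame V F Pr) × Heap F)))
      (s : State V F Pr) (hu : UnifFails u σ h) (hs : Resume cps s) :
      P.Step ⟨⟨p, σ, b, .goal (.unif u) :: K, ret⟩ :: st, h, cps⟩ s
  | succeed (p : Pr) (σ : Env V) (b : ℕ) (K : List (Instr V F Pr)) (ret : List V)
      (st : List (Frame V F Pr)) (h : Heap F) (cps : List (Option (List (Frame V F Pr) × Heap F))) :
      P.Step ⟨⟨p, σ, b, .goal .succeed :: K, ret⟩ :: st, h, cps⟩ ⟨⟨p, σ, b, K, ret⟩ :: st, h, cps⟩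
  | fail (p : Pr) (σ : Env V) (b : ℕ) (K : List (Instr V F Pr)) (ret : List V)
      (st : List (Frame V F Pr)) (h : Heap F) (cps : List (Option (List (Frame V F Pr) × Heap F)))
      (s : State V F Pr) (hs : Resume cps s) :
      P.Step ⟨⟨p, σ, b, .goal .fail :: K, ret⟩ :: st, h, cps⟩ s
  | conj (g₁ g₂ : Goal V F Pr) (p : Pr) (σ : Env V) (b : ℕ) (K : List (Instr V F Pr)) (ret : List V)
      (st : List (Frame V F Pr)) (h : Heap F) (cps : List (Option (List (Frame V F Pr) × Heap F))) :
      P.Step ⟨⟨p, σ, b, .goal (.conj g₁ g₂) :: K, ret⟩ :: st, h, cps⟩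
        ⟨⟨p, σ, b, .goal g₁ :: .goal g₂ :: K, ret⟩ :: st, h, cps⟩
  | disj (g₁ g₂ : Goal V F Pr) (p : Pr) (σ : Env V) (b : ℕ) (K : List (Instr V F Pr)) (ret : List V)
      (st : List (Frame V F Pr)) (h : Heap F) (cps : List (Option (List (Frame V F Pr) × Heap F))) :
      P.Step ⟨⟨p, σ, b, .goal (.disj g₁ g₂) :: K, ret⟩ :: st, h, cps⟩
        ⟨⟨p, σ, b, .goal g₁ :: K, ret⟩ :: st, h,
          some (⟨p, σ, b, .goal g₂ :: K, ret⟩ :: st, h) :: cps⟩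
  | ite (c t e : Goal V F Pr) (p : Pr) (σ : Env V) (b : ℕ) (K : List (Instr V F Pr)) (ret : List V)
      (st : List (Frame V F Pr)) (h : Heap F) (cps : List (Option (List (Frame V F Pr) × Heap F))) :
      P.Step ⟨⟨p, σ, b, .goal (.ite c t e) :: K, ret⟩ :: st, h, cps⟩
        ⟨⟨p, σ, b, .goal c :: .endCond cps.length :: .goal t :: K, ret⟩ :: st, h,
          some (⟨p, σ, b, .goal e :: K, ret⟩ :: st, h) :: cps⟩
  /-- The condition has succeeded: the choice point for the else branch is disabled, while those for
  further solutions of the condition are kept. -/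
  | endCond (d : ℕ) (p : Pr) (σ : Env V) (b : ℕ) (K : List (Instr V F Pr)) (ret : List V)
      (st : List (Frame V F Pr)) (h : Heap F) (cps : List (Option (List (Frame V F Pr) × Heap F))) :
      P.Step ⟨⟨p, σ, b, .endCond d :: K, ret⟩ :: st, h, cps⟩
        ⟨⟨p, σ, b, K, ret⟩ :: st, h, cps.set (cps.length - 1 - d) none⟩
  | quant (xs : List V) (g : Goal V F Pr) (p : Pr) (σ : Env V) (b : ℕ) (K : List (Instr V F Pr))
      (ret : List V) (st : List (Frame V F Pr)) (h : Heap F)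
      (cps : List (Option (List (Frame V F Pr) × Heap F))) :
      P.Step ⟨⟨p, σ, b, .goal (.quant false xs g) :: K, ret⟩ :: st, h, cps⟩
        ⟨⟨p, σ, b, .goal g :: K, ret⟩ :: st, h, cps⟩
  | commit (xs : List V) (g : Goal V F Pr) (p : Pr) (σ : Env V) (b : ℕ) (K : List (Instr V F Pr))
      (ret : List V) (st : List (Frame V F Pr)) (h : Heap F)
      (cps : List (Option (List (Frame V F Pr) × Heap F))) :
      P.Step ⟨⟨p, σ, b, .goal (.quant true xs g) :: K, ret⟩ :: st, h, cps⟩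
        ⟨⟨p, σ, b, .goal g :: .endCommit cps.length :: K, ret⟩ :: st, h, cps⟩
  /-- The goal inside a commit has succeeded: its remaining choice points are removed. -/
  | endCommit (d : ℕ) (p : Pr) (σ : Env V) (b : ℕ) (K : List (Instr V F Pr)) (ret : List V)
      (st : List (Frame V F Pr)) (h : Heap F) (cps : List (Option (List (Frame V F Pr) × Heap F))) :
      P.Step ⟨⟨p, σ, b, .endCommit d :: K, ret⟩ :: st, h, cps⟩
        ⟨⟨p, σ, b, K, ret⟩ :: st, h, cps.drop (cps.length - d)⟩
  | call (q : Pr) (ys : List V) (p : Pr) (σ : Env V) (b : ℕ) (K : List (Instr V F Pr)) (ret : List V)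
      (st : List (Frame V F Pr)) (h : Heap F) (cps : List (Option (List (Frame V F Pr) × Heap F)))
      (hm : CallModesOK σ (P.head q) ys) :
      P.Step ⟨⟨p, σ, b, .goal (.call q ys) :: K, ret⟩ :: st, h, cps⟩
        ⟨⟨q, enterEnv σ (P.head q) ys, h.length, [.goal (P.body q)], ys⟩ :: ⟨p, σ, b, K, ret⟩ :: st, h, cps⟩
  | exit (q : Pr) (σ' : Env V) (b' : ℕ) (ys : List V) (p : Pr) (σ : Env V) (b : ℕ)
      (K : List (Instr V F Pr)) (ret : List V) (st : List (Frame V F Pr)) (h : Heap F)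
      (cps : List (Option (List (Frame V F Pr) × Heap F)))
      (hm : ∀ x, (x, Mode.output) ∈ P.head q → σ' x ≠ none) :
      P.Step ⟨⟨q, σ', b', [], ys⟩ :: ⟨p, σ, b, K, ret⟩ :: st, h, cps⟩
        ⟨⟨p, exitEnv σ' σ (P.head q) ys, b, K, ret⟩ :: st, h, cps⟩

/-- A heap of ground terms in which the cell at address `a` belongs to a term of type `τ a`. -/
def Program.HeapTyping (P : Program V T F Pr) (τ : ℕ → T) (h : Heap F) : Prop :=
  ∀ a c, h[a]? = some c → P.sig (τ a) c.fn = some (c.args.map τ) ∧ ∀ a' ∈ c.args, a' < a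

/-- Start of an execution: some procedure is called, with its input arguments (if any) bound to well-typed
ground terms. -/
def Program.Initial (P : Program V T F Pr) (s : State V F Pr) : Prop :=
  ∃ p σ h τ, s = ⟨[⟨p, σ, h.length, [.goal (P.body p)], []⟩], h, []⟩ ∧ P.HeapTyping τ h ∧
    (∀ x, (x, Mode.input) ∈ P.head p → ∃ a, σ x = some a ∧ a < h.length ∧ τ a = P.varType p x) ∧
    (∀ x, (x, Mode.input) ∉ P.head p → σ x = none)

/-- The states that occur during executions. -/
def Program.Reachable (P : Program V T F Pr) (s : State V F Pr) : Prop :=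
  ∃ s₀, P.Initial s₀ ∧ Relation.ReflTransGen P.Step s₀ s

/-- The subterm at the position `π` of the term at address `a` is at address `b`. -/
def HeapPath (h : Heap F) : ℕ → List (Label F) → ℕ → Prop
  | a, [], b => a = b
  | a, l :: π, b => ∃ c a', h[a]? = some c ∧ c.fn = l.1 ∧ c.args[l.2]? = some a' ∧ HeapPath h a' π b

/-- In the activation `fr`, the subterm at the position `π` of the term bound to `x` is at address `b`. -/
def Frame.SubtermAt (fr : Frame V F Pr) (h : Heap F) (x : V) (π : List (Label F)) (b : ℕ) : Prop :=
  ∃ a, fr.env x = some a ∧ HeapPath h a π b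

end Exec

end Mercury

/-! The static half rests on two facts. First, every graph that occurs during the analysis is a
quotient of the initial graph by a type-preserving map (`Program.Good`). Hence locations stay
unique, every edge that the types suggest is present, and whatever an explicit unification has
achieved survives all later merging. The loop over children restores determinism after each merge
(`UnifyChildren.det_off`).

Second, each step of the interprocedural analysis either removes nodes or leaves the graph alone.
This relation is antisymmetric, so a pass without overall change has changed nothing at any
intermediate moment (`RunList.constant`). In the final pass, processing a call site has therefore
unified nothing: the resulting `α` is functional and closed under the rules, and it is a graph
homomorphism on the part of the callee's graph reachable from the formal arguments
(`exists_isCallMap`, `CallSite.spec`). Bottom-up order protects these maps from the treatment of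
later components (`Program.components_spec`).

The dynamic half is an invariant of the machine. Relative to the heap size `base` at its entry, an
activation satisfies `EnvOK`: a cell allocated since entry has a single node, and every occurrence
of an older cell has the node of some occurrence of that cell below an input argument. Unifications
preserve this because the graph satisfies their equations (`UnifSucceeds.envOK`). A return preserves
it because the call map sends the one node of a cell allocated by the callee to one node of the
caller, while older cells are traced through the callee's inputs to the caller's variables
(`EnvOK.exit`). Pointers go to smaller addresses, so comparison with `base` separates old cells from
new ones.

Sharing of a new cell is then immediate. An old cell is traced to two input arguments. If these
coincide, the nodes coincide as well, because from one variable only one node of each type can be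
reached (`Program.Good.nodeAt_unique_of_type`); otherwise it is the stated exception. -/

namespace Mercury

/-! ### Quotients of region points-to graphs. -/

section Graphs

variable {V T F Pr : Type*}

namespace RPTG

/-- No node has two out-edges with the same label. -/
def Det (G : RPTG V T F) : Prop :=
  ∀ n l m m', (n, l, m) ∈ G.edges → (n, l, m') ∈ G.edges → m = m'

/-- `G'` is the quotient of `G` by the type-preserving map `ρ`. -/
structure IsQuot (G : RPTG V T F) (ρ : Node V T → Node V T) (G' : RPTG V T F) : Prop where
  typed : ∀ n, (ρ n).2 = n.2
  nodes : G'.nodes = ρ '' G.nodes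
  vars : ∀ k x, x ∈ G'.vars k ↔ ∃ k', ρ k' = k ∧ x ∈ G.vars k'
  edges : ∀ n l m, (n, l, m) ∈ G'.edges ↔ ∃ n' m', (n', l, m') ∈ G.edges ∧ ρ n' = n ∧ ρ m' = m

theorem IsQuot.refl (G : RPTG V T F) : G.IsQuot id G :=
  ⟨fun _ => rfl, by simp, by simp, by simp⟩

theorem IsQuot.comp {G G₁ G₂ : RPTG V T F} {ρ₁ ρ₂ : Node V T → Node V T} (h₁ : G.IsQuot ρ₁ G₁)
    (h₂ : G₁.IsQuot ρ₂ G₂) : G.IsQuot (ρ₂ ∘ ρ₁) G₂ where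
  typed n := (h₂.typed _).trans (h₁.typed n)
  nodes := by rw [h₂.nodes, h₁.nodes, Set.image_image]; rfl
  vars k x := by
    rw [h₂.vars]
    constructor
    · rintro ⟨k', rfl, hx⟩
      obtain ⟨k'', rfl, hx'⟩ := (h₁.vars _ _).1 hx
      exact ⟨k'', rfl, hx'⟩
    · rintro ⟨k', rfl, hx⟩
      exact ⟨ρ₁ k', rfl, (h₁.vars _ _).2 ⟨k', rfl, hx⟩⟩
  edges n l m := by
    rw [h₂.edges]
    constructor
    · rintro ⟨n', m', he, rfl, rfl⟩
      obtain ⟨n'', m'', he', rfl, rfl⟩ := (h₁.edges _ _ _).1 he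
      exact ⟨n'', m'', he', rfl, rfl⟩
    · rintro ⟨n', m', he, rfl, rfl⟩
      exact ⟨ρ₁ n', ρ₁ m', (h₁.edges _ _ _).2 ⟨n', m', he, rfl, rfl⟩, rfl, rfl⟩

theorem IsQuot.mem_edges {G G' : RPTG V T F} {ρ : Node V T → Node V T} (h : G.IsQuot ρ G')
    {n m : Node V T} {l : Label F} (he : (n, l, m) ∈ G.edges) : (ρ n, l, ρ m) ∈ G'.edges :=
  (h.edges _ _ _).2 ⟨n, m, he, rfl, rfl⟩

theorem IsQuot.loc {G G' : RPTG V T F} {ρ : Node V T → Node V T} (h : G.IsQuot ρ G')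
    {x : V} {n : Node V T} (hx : G.Loc x n) : G'.Loc x (ρ n) :=
  ⟨h.nodes ▸ Set.mem_image_of_mem _ hx.1, (h.vars _ _).2 ⟨n, rfl, hx.2⟩⟩

theorem IsQuot.path {G G' : RPTG V T F} {ρ : Node V T → Node V T} (h : G.IsQuot ρ G')
    {π : List (Label F)} {n m : Node V T} (hp : G.Path n π m) : G'.Path (ρ n) π (ρ m) := by
  induction π generalizing n with
  | nil => exact congrArg ρ hp
  | cons l π ih =>
    obtain ⟨k, he, hp⟩ := hp
    exact ⟨ρ k, h.mem_edges he, ih hp⟩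

theorem Det.path_unique {G : RPTG V T F} (h : G.Det) {π : List (Label F)} {n m m' : Node V T}
    (hm : G.Path n π m) (hm' : G.Path n π m') : m = m' := by
  induction π generalizing n with
  | nil => exact hm.symm.trans hm'
  | cons l π ih =>
    obtain ⟨k, he, hp⟩ := hm
    obtain ⟨k', he', hp'⟩ := hm'
    obtain rfl := h _ _ _ _ he he'
    exact ih hp hp'

theorem Path.reach {G : RPTG V T F} {π : List (Label F)} {n m : Node V T} (h : G.Path n π m) :
    G.Reach n m := by
  induction π generalizing n with
  | nil => exact h ▸ .refl
  | cons l π ih =>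
    obtain ⟨k, he, hp⟩ := h
    exact .head ⟨l, he⟩ (ih hp)

theorem NodeAt.regionShare {G : RPTG V T F} {x y : V} {π ρ : List (Label F)} {n : Node V T}
    (hx : G.NodeAt x π n) (hy : G.NodeAt y ρ n) : G.RegionShare x y := by
  obtain ⟨nx, hx, hpx⟩ := hx
  obtain ⟨ny, hy, hpy⟩ := hy
  exact ⟨nx, ny, n, hx, hy, hpx.reach, hpy.reach⟩

/-- Either nothing has changed, or nodes have been removed. -/
def Shrinks (G G' : RPTG V T F) : Prop := G'.nodes ⊂ G.nodes ∨ G' = G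

theorem Shrinks.refl (G : RPTG V T F) : G.Shrinks G := .inr rfl

theorem Shrinks.subset {G G' : RPTG V T F} (h : G.Shrinks G') : G'.nodes ⊆ G.nodes := by
  obtain h | rfl := h
  · exact h.subset
  · exact subset_rfl

theorem Shrinks.trans {G₁ G₂ G₃ : RPTG V T F} (h : G₁.Shrinks G₂) (h' : G₂.Shrinks G₃) :
    G₁.Shrinks G₃ := by
  obtain h | rfl := h
  · exact .inl (h'.subset.trans_ssubset h)
  · exact h'

/-- A strict loss of nodes cannot be undone. This is what turns "no change over a whole pass" into
"no change in any step of it". -/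
theorem Shrinks.antisymm {G G' : RPTG V T F} (h : G.Shrinks G') (h' : G'.Shrinks G) : G' = G := by
  obtain h | rfl := h
  · exact absurd h'.subset h.not_subset
  · rfl

end RPTG

/-! ### Typed graphs and the correctness of unification. -/

open RPTG

/-- Edges are in accordance with the types of the nodes, each variable has at most one location, which has the
type of the variable, and all edges that the types suggest are there. -/
structure Program.TypedGraph (P : Program V T F Pr) (p : Pr) (G : RPTG V T F) : Prop where
  src : ∀ {n l m}, (n, l, m) ∈ G.edges → n ∈ G.nodes
  tgt : ∀ {n l m}, (n, l, m) ∈ G.edges → m ∈ G.nodes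
  edge : ∀ {n l m}, (n, l, m) ∈ G.edges → ∃ ts, P.sig n.2 l.1 = some ts ∧ ts[l.2]? = some m.2
  total : ∀ {n} {l : Label F} {ts t}, n ∈ G.nodes → P.sig n.2 l.1 = some ts → ts[l.2]? = some t →
    ∃ m, (n, l, m) ∈ G.edges
  vars : ∀ {n x}, x ∈ G.vars n → n ∈ G.nodes
  loc_exists : ∀ {x}, x ∈ P.vars p → ∃ n, G.Loc x n
  loc_unique : ∀ {x n m}, G.Loc x n → G.Loc x m → n = m
  loc_type : ∀ {x n}, G.Loc x n → n.2 = P.varType p x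

namespace Program.TypedGraph

variable {P : Program V T F Pr} {p : Pr} {G G' : RPTG V T F}

theorem tgt_type (h : P.TypedGraph p G) {n m t : _} {l : Label F} {ts : List T}
    (he : (n, l, m) ∈ G.edges) (hs : P.sig n.2 l.1 = some ts) (ht : ts[l.2]? = some t) : m.2 = t := by
  obtain ⟨ts', hs', ht'⟩ := h.edge he
  obtain rfl : ts = ts' := by simpa [hs] using hs'
  simpa [ht'] using ht

/-- The signature determines the type of the target from the label and the type of the source, even
across two graphs. So unification that starts at nodes of equal type only ever merges nodes of equal
type. -/
theorem same_type (h : P.TypedGraph p G) {G₂ : RPTG V T F} {p₂ : Pr} (h₂ : P.TypedGraph p₂ G₂)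
    {n n₂ m m₂ : Node V T} {l : Label F} (he : (n, l, m) ∈ G.edges) (he₂ : (n₂, l, m₂) ∈ G₂.edges)
    (hn : n.2 = n₂.2) : m.2 = m₂.2 := by
  obtain ⟨ts, hs, ht⟩ := h₂.edge he₂
  exact h.tgt_type he (hn ▸ hs) ht

theorem quot (h : P.TypedGraph p G) {ρ : Node V T → Node V T} (hq : G.IsQuot ρ G') :
    P.TypedGraph p G' where
  src he := by
    obtain ⟨n', m', he', rfl, rfl⟩ := (hq.edges _ _ _).1 he
    exact hq.nodes ▸ Set.mem_image_of_mem _ (h.src he')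
  tgt he := by
    obtain ⟨n', m', he', rfl, rfl⟩ := (hq.edges _ _ _).1 he
    exact hq.nodes ▸ Set.mem_image_of_mem _ (h.tgt he')
  edge he := by
    obtain ⟨n', m', he', rfl, rfl⟩ := (hq.edges _ _ _).1 he
    simpa only [hq.typed] using h.edge he'
  total hn hs ht := by
    rw [hq.nodes] at hn
    obtain ⟨n', hn, rfl⟩ := hn
    rw [hq.typed] at hs
    obtain ⟨m, he⟩ := h.total hn hs ht
    exact ⟨ρ m, hq.mem_edges he⟩
  vars hx := by
    obtain ⟨n', rfl, hx'⟩ := (hq.vars _ _).1 hx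
    exact hq.nodes ▸ Set.mem_image_of_mem _ (h.vars hx')
  loc_exists hx := by
    obtain ⟨n, hn⟩ := h.loc_exists hx
    exact ⟨ρ n, hq.loc hn⟩
  loc_unique hn hm := by
    obtain ⟨n', rfl, hx⟩ := (hq.vars _ _).1 hn.2
    obtain ⟨m', rfl, hy⟩ := (hq.vars _ _).1 hm.2
    rw [h.loc_unique ⟨h.vars hx, hx⟩ ⟨h.vars hy, hy⟩]
  loc_type hn := by
    obtain ⟨n', rfl, hx⟩ := (hq.vars _ _).1 hn.2
    rw [hq.typed, h.loc_type ⟨h.vars hx, hx⟩]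

theorem _root_.Mercury.RPTG.redirect_type {n m : Node V T} (ht : n.2 = m.2) (k : Node V T) :
    (redirect n m k).2 = k.2 := by
  unfold redirect
  split_ifs with h
  · rw [h, ht]
  · rfl

theorem _root_.Mercury.RPTG.isQuot_merge {n m : Node V T} (hn : n ∈ G.nodes) (hne : n ≠ m)
    (ht : n.2 = m.2) : G.IsQuot (redirect n m) (G.merge n m) where
  typed := redirect_type ht
  nodes := by
    ext k
    constructor
    · rintro ⟨hk, hkm⟩
      exact ⟨k, hk, if_neg hkm⟩
    · rintro ⟨k', hk', rfl⟩
      unfold redirect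
      split_ifs with h
      · exact ⟨hn, hne⟩
      · exact ⟨hk', h⟩
  vars _ _ := Iff.rfl
  edges n' l m' := by
    constructor
    · rintro ⟨⟨a, b, c⟩, he, h⟩
      simp only [Prod.mk.injEq] at h
      obtain ⟨rfl, rfl, rfl⟩ := h
      exact ⟨a, c, he, rfl, rfl⟩
    · rintro ⟨a, c, he, rfl, rfl⟩
      exact ⟨(a, l, c), he, rfl⟩

theorem unifyChildren {n : Node V T} {ρ : Node V T → Node V T} (h : UnifyChildren G n ρ G')
    (hG : P.TypedGraph p G) : G.IsQuot ρ G' := by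
  induction h with
  | done G n h => exact .refl G
  | next G G₁ G₂ n m m' l ρ₁ ρ₂ hm hm' hne h₁ h₂ ih₁ ih₂ =>
    have q := isQuot_merge (hG.tgt hm) hne (hG.same_type hG hm hm' rfl)
    have q₁ := ih₁ (hG.quot q)
    exact q.comp (q₁.comp (ih₂ ((hG.quot q).quot q₁)))

theorem _root_.Mercury.RPTG.UnifyChildren.nodes_subset {n : Node V T} {ρ : Node V T → Node V T}
    (h : UnifyChildren G n ρ G') : G'.nodes ⊆ G.nodes := by
  induction h with
  | done G n h => exact subset_rfl
  | next G G₁ G₂ n m m' l ρ₁ ρ₂ hm hm' hne h₁ h₂ ih₁ ih₂ =>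
    exact ih₂.trans (ih₁.trans Set.sdiff_subset)

/-- Merging creates clashes at the surviving node `n` only: an edge leaving another node left that
same node before, and redirection sends equal targets to equal targets. -/
theorem _root_.Mercury.RPTG.det_merge {n m : Node V T} {S : Set (Node V T)}
    (hS : ∀ k ∉ S, ∀ l a b, (k, l, a) ∈ G.edges → (k, l, b) ∈ G.edges → a = b) (k : Node V T)
    (hk : k ∉ S) (hkn : k ≠ n) (l : Label F) (a b : Node V T) (ha : (k, l, a) ∈ (G.merge n m).edges)
    (hb : (k, l, b) ∈ (G.merge n m).edges) : a = b := by
  obtain ⟨⟨k₁, l₁, a'⟩, ha, h₁⟩ := ha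
  obtain ⟨⟨k₂, l₂, b'⟩, hb, h₂⟩ := hb
  simp only [Prod.mk.injEq] at h₁ h₂
  obtain ⟨h₁, rfl, rfl⟩ := h₁
  obtain ⟨h₂, rfl, rfl⟩ := h₂
  have e : ∀ k', k = redirect n m k' → k' = k := by
    intro k' h
    unfold redirect at h
    split_ifs at h
    · exact absurd h hkn
    · exact h.symm
  rw [e _ h₁] at ha
  rw [e _ h₂] at hb
  rw [hS k hk _ _ _ ha hb]

/-- `S` holds the nodes whose clashes are left to the enclosing calls. The recursive call for a
child runs with `n` added to `S`, since the loop at `n` is not finished; the rest of that loop then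
takes care of `n`. The outermost call has `S = ∅`. -/
theorem _root_.Mercury.RPTG.UnifyChildren.det_off {n : Node V T} {ρ : Node V T → Node V T}
    (h : UnifyChildren G n ρ G') (S : Set (Node V T))
    (hS : ∀ k ∉ S, k ≠ n → ∀ l a b, (k, l, a) ∈ G.edges → (k, l, b) ∈ G.edges → a = b) :
    ∀ k ∉ S, ∀ l a b, (k, l, a) ∈ G'.edges → (k, l, b) ∈ G'.edges → a = b := by
  induction h generalizing S with
  | done G n h =>
    intro k hk
    by_cases hkn : k = n
    · exact hkn ▸ h
    · exact hS k hk hkn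
  | next G G₁ G₂ n m m' l ρ₁ ρ₂ hm hm' hne h₁ h₂ ih₁ ih₂ =>
    refine ih₂ S fun k hk hkn => ih₁ (insert n S) ?_ k (by simp [hk, hkn])
    refine fun k hk => det_merge (fun k hk => ?_) k hk
    simp only [Set.mem_insert_iff, not_or] at hk
    exact hS k hk.2 hk.1

theorem _root_.Mercury.RPTG.Unify.det {n m : Node V T} {ρ : Node V T → Node V T}
    (h : G.Unify n m ρ G') (hG : G.Det) : G'.Det := by
  obtain ⟨-, -, rfl⟩ | ⟨-, ρ', h, -⟩ := h
  · exact hG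
  · exact fun k => h.det_off ∅ (fun k hk => det_merge (S := ∅) (fun k _ => hG k) k hk) k (by simp)

theorem unify (hG : P.TypedGraph p G) {n m : Node V T} {ρ : Node V T → Node V T} (hn : n ∈ G.nodes)
    (ht : n.2 = m.2) (h : G.Unify n m ρ G') : G.IsQuot ρ G' ∧ ρ n = ρ m := by
  obtain ⟨rfl, rfl, rfl⟩ | ⟨hne, ρ', h, rfl⟩ := h
  · exact ⟨.refl G', rfl⟩
  · have q := isQuot_merge hn hne ht
    refine ⟨q.comp ((hG.quot q).unifyChildren h), ?_⟩
    simp [redirect]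

/-- The first merge removes `m`, and no node is ever added. -/
theorem _root_.Mercury.RPTG.Unify.ssubset {n m : Node V T} {ρ : Node V T → Node V T} (hm : m ∈ G.nodes)
    (h : G.Unify n m ρ G') (hne : n ≠ m) : G'.nodes ⊂ G.nodes := by
  obtain ⟨rfl, -⟩ | ⟨-, ρ', h, -⟩ := h
  · exact absurd rfl hne
  · exact h.nodes_subset.trans_ssubset (Set.sdiff_singleton_ssubset.2 hm)

theorem _root_.Mercury.Program.typedGraph_initGraph (P : Program V T F Pr) (p : Pr) :
    P.TypedGraph p (P.initGraph p) where
  src := by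
    rintro ⟨n, t⟩ l ⟨m, t'⟩ ⟨x, hx, rfl, h, he⟩
    exact ⟨n, hx, rfl, he.1⟩
  tgt := by
    rintro ⟨n, t⟩ ⟨f, i⟩ ⟨m, t'⟩ ⟨x, hx, h, rfl, ht, ts, hs, hi⟩
    exact ⟨m, hx, rfl, ht.tail ⟨f, ts, hs, List.mem_of_getElem? hi⟩⟩
  edge := by
    rintro ⟨n, t⟩ ⟨f, i⟩ ⟨m, t'⟩ ⟨x, hx, h, rfl, ht, ts, hs, hi⟩
    exact ⟨ts, hs, hi⟩
  total := by
    rintro ⟨n, t⟩ ⟨f, i⟩ ts t' ⟨x, hx, rfl, ht⟩ hs hi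
    exact ⟨(n, t'), n, hx, rfl, rfl, ht, ts, hs, hi⟩
  vars := by
    rintro n x ⟨y, hy, rfl, rfl⟩
    exact ⟨x, hy, rfl, .refl⟩
  loc_exists := fun {x} hx => ⟨(x, P.varType p x), ⟨x, hx, rfl, .refl⟩, x, hx, rfl, rfl⟩
  loc_unique := by
    rintro x n m ⟨-, y, -, rfl, rfl⟩ ⟨-, z, -, rfl, rfl⟩
    rfl
  loc_type := by
    rintro x n ⟨-, y, -, rfl, rfl⟩
    rfl

end Program.TypedGraph

/-- Invariant of the analysis: the graph is a quotient of the initial one, without ambiguous edges. -/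
structure Program.Good (P : Program V T F Pr) (p : Pr) (G : RPTG V T F) : Prop where
  det : G.Det
  quot : ∃ θ, (P.initGraph p).IsQuot θ G

namespace Program.Good

variable {P : Program V T F Pr} {p : Pr} {G G' : RPTG V T F}

theorem typedGraph (h : P.Good p G) : P.TypedGraph p G :=
  let ⟨_, hθ⟩ := h.quot
  (P.typedGraph_initGraph p).quot hθ

theorem init (P : Program V T F Pr) (p : Pr) : P.Good p (P.initGraph p) where
  det := by
    rintro ⟨n, t⟩ l ⟨m, u⟩ ⟨m', u'⟩ h h'
    have e := (P.typedGraph_initGraph p).same_type (P.typedGraph_initGraph p) h h' rfl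
    obtain ⟨x, hx, h₁, h₂, he⟩ := h
    obtain ⟨x', hx', h₁', h₂', he'⟩ := h'
    exact Prod.ext (h₂.trans (h₁.symm.trans (h₁'.trans h₂'.symm))) e
  quot := ⟨id, .refl _⟩

theorem unify (h : P.Good p G) {n m : Node V T} {ρ : Node V T → Node V T} (hn : n ∈ G.nodes)
    (ht : n.2 = m.2) (hu : G.Unify n m ρ G') : P.Good p G' := by
  obtain ⟨θ, hθ⟩ := h.quot
  exact ⟨hu.det h.det, ρ ∘ θ, hθ.comp (h.typedGraph.unify hn ht hu).1⟩

/-- The type-based region graphs have paths for all typed paths. -/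
theorem _root_.Mercury.Program.TypedGraph.initGraph_path {π : List (Label F)} {n m : Node V T}
    {x : V} (hG : P.TypedGraph p G) (hp : G.Path n π m) (hx : x ∈ P.vars p)
    (hn : n.2 ∈ P.typeNodes (P.varType p x)) : (P.initGraph p).Path (x, n.2) π (x, m.2) := by
  induction π generalizing n with
  | nil => exact congrArg (fun k : Node V T => (x, k.2)) hp
  | cons l π ih =>
    obtain ⟨k, he, hp⟩ := hp
    obtain ⟨ts, hs, ht⟩ := hG.edge he
    exact ⟨(x, k.2), ⟨x, hx, rfl, rfl, hn, ts, hs, ht⟩,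
      ih hp (hn.tail ⟨l.1, ts, hs, List.mem_of_getElem? ht⟩)⟩

/-- From the location of a variable, only one node of each type can be reached. -/
theorem nodeAt_unique_of_type (h : P.Good p G) {x : V} {π ρ : List (Label F)} {n m : Node V T}
    (hn : G.NodeAt x π n) (hm : G.NodeAt x ρ m) (ht : n.2 = m.2) : n = m := by
  obtain ⟨θ, hθ⟩ := h.quot
  -- A path in `G` from the location of `x` can be replayed in the type graph of `x`, where its
  -- endpoint depends only on the type reached. The image of the replayed path under `θ` has the
  -- same start and labels, so determinism identifies the endpoints.
  have key : ∀ {π k}, G.NodeAt x π k → k = θ (x, k.2) := by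
    rintro π k ⟨k₀, hk₀, hp⟩
    obtain ⟨k', rfl, y, hy, rfl, rfl⟩ := (hθ.vars _ _).1 hk₀.2
    have hp' := h.typedGraph.initGraph_path hp hy (by rw [hθ.typed]; exact .refl)
    rw [hθ.typed] at hp'
    exact h.det.path_unique hp (hθ.path hp')
  rw [key hn, key hm, ht]

theorem nodeAt_unique (h : P.Good p G) {x : V} {π : List (Label F)} {n m : Node V T}
    (hn : G.NodeAt x π n) (hm : G.NodeAt x π m) : n = m := by
  obtain ⟨n₀, hn₀, hn⟩ := hn
  obtain ⟨m₀, hm₀, hm⟩ := hm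
  obtain rfl := h.typedGraph.loc_unique hn₀ hm₀
  exact h.det.path_unique hn hm

end Program.Good

/-! ### Control structure -/

theorem RunList.invariant {ι S : Type*} {R : ι → S → S → Prop} {I : S → Prop} {is : List ι} {s t : S}
    (h : RunList R is s t) (step : ∀ i ∈ is, ∀ s t, I s → R i s t → I t) (hs : I s) : I t := by
  induction h with
  | nil => exact hs
  | cons i is s t u h _ ih =>
    exact ih (fun j hj => step j (List.mem_cons_of_mem _ hj)) (step i List.mem_cons_self _ _ hs h)

/-- A run that does not change `π` in the end has not changed it in between either. -/
theorem RunList.constant {ι S X : Type*} {R : ι → S → S → Prop} {I : S → Prop} {π : S → X}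
    {le : X → X → Prop} (refl : ∀ a, le a a) (trans : ∀ {a b c}, le a b → le b c → le a c)
    (antisymm : ∀ {a b}, le a b → le b a → b = a) {is : List ι} {s t : S} (h : RunList R is s t)
    (step : ∀ i ∈ is, ∀ s t, I s → R i s t → I t ∧ le (π s) (π t)) (hs : I s) :
    le (π s) (π t) ∧ (π t = π s → ∀ i ∈ is, ∃ s' t', I s' ∧ R i s' t' ∧ π s' = π s ∧ π t' = π s) := by
  induction h with
  | nil => exact ⟨refl _, by simp⟩
  | cons i is s t u h _ ih =>
    obtain ⟨ht, hst⟩ := step i List.mem_cons_self _ _ hs h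
    obtain ⟨htu, ih⟩ := ih (fun j hj => step j (List.mem_cons_of_mem _ hj)) ht
    refine ⟨trans hst htu, fun hus => ?_⟩
    -- The final value equals the initial one, so the value in between is squeezed.
    have e : π t = π s := antisymm hst (hus ▸ htu)
    intro j hj
    obtain rfl | hj := List.mem_cons.1 hj
    · exact ⟨s, t, hs, h, rfl, e⟩
    · simpa only [e] using ih (hus.trans e.symm) j hj

/-- Besides the invariant, stabilisation provides one last pass from the final state to itself. The
fixpoint properties are read off that pass. -/
theorem RepeatUntilStable.invariant {S : Type*} {R : S → S → Prop} {I : S → Prop} {s t : S}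
    (h : RepeatUntilStable R s t) (step : ∀ s t, I s → R s t → I t) (hs : I s) : I t ∧ R t t := by
  induction h with
  | stable s h => exact ⟨hs, h⟩
  | again s t u h _ _ ih => exact ih (step _ _ hs h)

/-! ### Intraprocedural analysis -/

/-- What the intraprocedural analysis achieves for a unification. -/
def RPTG.Satisfies (G : RPTG V T F) : Unif V F → Prop
  | .assign x y => ∃ n, G.Loc x n ∧ G.Loc y n
  | .construct x f ys => ∀ (i : ℕ) y, ys[i]? = some y →
      ∃ n m, G.Loc x n ∧ G.Loc y m ∧ (n, (f, i), m) ∈ G.edges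
  | .deconstruct x f ys => ∀ (i : ℕ) y, ys[i]? = some y →
      ∃ n m, G.Loc x n ∧ G.Loc y m ∧ (n, (f, i), m) ∈ G.edges
  | .test _ _ => True

theorem RPTG.IsQuot.loc_edge {G G' : RPTG V T F} {ρ : Node V T → Node V T} (hq : G.IsQuot ρ G')
    {x y : V} {l : Label F} (h : ∃ n m, G.Loc x n ∧ G.Loc y m ∧ (n, l, m) ∈ G.edges) :
    ∃ n m, G'.Loc x n ∧ G'.Loc y m ∧ (n, l, m) ∈ G'.edges := by
  obtain ⟨n, m, hn, hm, he⟩ := h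
  exact ⟨ρ n, ρ m, hq.loc hn, hq.loc hm, hq.mem_edges he⟩

/-- The conditions only assert the existence of locations and edges, so they pass to quotients, and
later merging cannot destroy them. -/
theorem RPTG.Satisfies.quot {G G' : RPTG V T F} {ρ : Node V T → Node V T} {u : Unif V F}
    (h : G.Satisfies u) (hq : G.IsQuot ρ G') : G'.Satisfies u := by
  cases u with
  | assign x y =>
    obtain ⟨n, hx, hy⟩ := h
    exact ⟨ρ n, hq.loc hx, hq.loc hy⟩
  | construct x f ys => exact fun i y hi => hq.loc_edge (h i y hi)
  | deconstruct x f ys => exact fun i y hi => hq.loc_edge (h i y hi)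
  | test x y => trivial

variable {P : Program V T F Pr} {p : Pr}

theorem UnifyArgs.spec {x : V} {f : F} {ts : List T} {ys : List (V × ℕ)} {G G' : RPTG V T F}
    (h : UnifyArgs x f ys G G') (hG : P.Good p G) (hs : P.sig (P.varType p x) f = some ts)
    (hys : ∀ yi ∈ ys, ts[yi.2]? = some (P.varType p yi.1)) :
    P.Good p G' ∧ (∃ ρ, G.IsQuot ρ G') ∧
      ∀ yi ∈ ys, ∃ n m, G'.Loc x n ∧ G'.Loc yi.1 m ∧ (n, (f, yi.2), m) ∈ G'.edges := by
  unfold UnifyArgs at h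
  induction h with
  | nil s => exact ⟨hG, ⟨id, .refl _⟩, by simp⟩
  | cons yi ys G G₁ G₂ h _ ih =>
    obtain ⟨n, k, m, ρ, hn, he, hm, hu⟩ := h
    have tG := hG.typedGraph
    have ht : k.2 = m.2 := by
      rw [tG.loc_type hm]
      exact tG.tgt_type he (tG.loc_type hn ▸ hs) (hys yi List.mem_cons_self)
    obtain ⟨q, e⟩ := tG.unify (tG.tgt he) ht hu
    obtain ⟨hG₂, ⟨ρ', q'⟩, ih⟩ := ih (hG.unify (tG.tgt he) ht hu)
      fun z hz => hys z (List.mem_cons_of_mem _ hz)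
    refine ⟨hG₂, ⟨_, q.comp q'⟩, fun z hz => ?_⟩
    obtain rfl | hz := List.mem_cons.1 hz
    -- Since `ρ k = ρ m`, the image of the edge to `k` now ends at the location of the argument; the
    -- remaining unifications only pass to a further quotient.
    · exact q'.loc_edge ⟨ρ n, ρ m, q.loc hn, q.loc hm, e ▸ q.mem_edges he⟩
    · exact ih z hz

theorem IntraUnif.spec {u : Unif V F} {G G' : RPTG V T F} (h : IntraUnif u G G') (hG : P.Good p G)
    (hu : P.UnifOK p u) : P.Good p G' ∧ (∃ ρ, G.IsQuot ρ G') ∧ G'.Satisfies u := by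
  have args : ∀ (x : V) (f : F) (ys : List V), UnifyArgs x f ys.zipIdx G G' →
      P.sig (P.varType p x) f = some (ys.map (P.varType p)) →
      P.Good p G' ∧ (∃ ρ, G.IsQuot ρ G') ∧ ∀ (i : ℕ) y, ys[i]? = some y →
        ∃ n m, G'.Loc x n ∧ G'.Loc y m ∧ (n, (f, i), m) ∈ G'.edges := by
    intro x f ys h hs
    obtain ⟨h₁, h₂, h₃⟩ := h.spec hG hs (by
      rintro ⟨y, i⟩ hy
      simp [List.mem_zipIdx_iff_getElem?.1 hy])
    exact ⟨h₁, h₂, fun i y hi => h₃ (y, i) (List.mem_zipIdx_iff_getElem?.2 hi)⟩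
  cases u with
  | assign x y =>
    obtain ⟨n, m, ρ, hn, hm, h⟩ := h
    have tG := hG.typedGraph
    have ht : n.2 = m.2 := by rw [tG.loc_type hn, tG.loc_type hm]; exact hu
    obtain ⟨q, e⟩ := tG.unify hn.1 ht h
    exact ⟨hG.unify hn.1 ht h, ⟨ρ, q⟩, ρ n, q.loc hn, e ▸ q.loc hm⟩
  | construct x f ys => exact args x f ys h hu.2
  | deconstruct x f ys => exact args x f ys h hu.2
  | test x y =>
    obtain rfl := h
    exact ⟨hG, ⟨id, .refl _⟩, trivial⟩

theorem runList_intraUnif {us : List (Unif V F)} {G G' : RPTG V T F} (h : RunList IntraUnif us G G')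
    (hG : P.Good p G) (hus : ∀ u ∈ us, P.UnifOK p u) :
    P.Good p G' ∧ (∃ ρ, G.IsQuot ρ G') ∧ ∀ u ∈ us, G'.Satisfies u := by
  induction h with
  | nil s => exact ⟨hG, ⟨id, .refl _⟩, by simp⟩
  | cons u us G G₁ G₂ h _ ih =>
    obtain ⟨h₁, ⟨ρ, q⟩, hu⟩ := h.spec hG (hus u List.mem_cons_self)
    obtain ⟨h₂, ⟨ρ', q'⟩, hs⟩ := ih h₁ fun v hv => hus v (List.mem_cons_of_mem _ hv)
    refine ⟨h₂, ⟨_, q.comp q'⟩, fun v hv => ?_⟩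
    obtain rfl | hv := List.mem_cons.1 hv
    · exact hu.quot q'
    · exact hs v hv

theorem Program.Intraproc.spec (hP : P.WellFormed) {G : RPTG V T F} (h : P.Intraproc p G) :
    P.Good p G ∧ ∀ u ∈ (P.body p).unifs, G.Satisfies u := by
  obtain ⟨us, hus, h⟩ := h
  obtain ⟨h₁, -, h₂⟩ := runList_intraUnif h (.init P p) fun u hu => hP.unifs_ok p u (hus.mem_iff.1 hu)
  exact ⟨h₁, fun u hu => h₂ u (hus.mem_iff.2 hu)⟩

end Graphs

end Mercury

namespace Mercury

/-! ### Interprocedural analysis: call maps from call sites. -/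

section InterSpec

variable {V T F Pr : Type*}

open RPTG

/-- The variables that occur in unifications and calls of a goal are variables of the goal. -/
theorem Goal.unif_vars_subset {g : Goal V F Pr} {u : Unif V F} (hu : u ∈ g.unifs) : u.vars ⊆ g.vars := by
  induction g <;>
    simp only [Goal.unifs, List.not_mem_nil, List.mem_cons, List.mem_append, or_false] at hu <;>
    simp only [Goal.vars] <;> grind

theorem Goal.call_args_mem_vars {g : Goal V F Pr} {q : Pr} {ys : List V} (hc : (q, ys) ∈ g.calls) {y : V}
    (hy : y ∈ ys) : y ∈ g.vars := by
  induction g <;>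
    simp only [Goal.calls, List.not_mem_nil, List.mem_cons, List.mem_append, or_false,
      Prod.mk.injEq] at hc <;>
    simp only [Goal.vars, Set.mem_union, Set.mem_ofPred_eq] <;> grind

theorem Program.mem_vars_of_unif {P : Program V T F Pr} {p : Pr} {u : Unif V F}
    (hu : u ∈ (P.body p).unifs) {x : V} (hx : x ∈ u.vars) : x ∈ P.vars p :=
  .inr (Goal.unif_vars_subset hu hx)

theorem Program.mem_vars_of_call {P : Program V T F Pr} {p q : Pr} {ys : List V}
    (hc : (q, ys) ∈ (P.body p).calls) {y : V} (hy : y ∈ ys) : y ∈ P.vars p :=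
  .inr (Goal.call_args_mem_vars hc hy)

/-- `α` maps what is reachable from the formal arguments `xs` into `Gp`, and formal to actual arguments. -/
structure IsCallMap (Gq Gp : RPTG V T F) (xs ys : List V) (α : Node V T → Node V T) : Prop where
  args : ∀ (k : ℕ) x y n m, xs[k]? = some x → ys[k]? = some y → Gq.Loc x n → Gp.Loc y m → α n = m
  edges : ∀ x ∈ xs, ∀ n₀ n l m, Gq.Loc x n₀ → Gq.Reach n₀ n → (n, l, m) ∈ Gq.edges →
    (α n, l, α m) ∈ Gp.edges

namespace Alpha

/-- No node is related to two nodes. -/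
def Functional (α : Alpha V T) : Prop := ∀ n m m', (n, m) ∈ α → (n, m') ∈ α → m = m'

/-- `α` relates nodes to nodes of `G` of the same type. -/
def Typed (α : Alpha V T) (G : RPTG V T F) : Prop := ∀ n m, (n, m) ∈ α → n.2 = m.2 ∧ m ∈ G.nodes

theorem Typed.rename {α : Alpha V T} {G G' : RPTG V T F} {ρ : Node V T → Node V T} (h : α.Typed G)
    (hq : G.IsQuot ρ G') : (α.rename ρ).Typed G' := by
  rintro n m ⟨⟨n', m'⟩, he, h'⟩
  simp only [Prod.mk.injEq] at h'
  obtain ⟨rfl, rfl⟩ := h'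
  obtain ⟨ht, hm⟩ := h _ _ he
  exact ⟨by rw [hq.typed]; exact ht, hq.nodes ▸ Set.mem_image_of_mem _ hm⟩

end Alpha

variable {P : Program V T F Pr} {p q : Pr}

/-- Every unification here joins two different nodes and so removes one. If no node is lost, none
took place, and `α` was functional from the start. -/
theorem EnsureFun.spec {r r' : RPTG V T F × Alpha V T} (h : EnsureFun r r') (hG : P.Good p r.1)
    (hα : r.2.Typed r.1) : P.Good p r'.1 ∧ r'.2.Typed r'.1 ∧ (∃ ρ, r.1.IsQuot ρ r'.1) ∧
      (r'.1.nodes ⊂ r.1.nodes ∨ r' = r ∧ r.2.Functional) := by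
  induction h with
  | done G α h => exact ⟨hG, hα, ⟨id, .refl _⟩, .inr ⟨rfl, h⟩⟩
  | next G G' α n m m' ρ r hm hm' hne hu _ ih =>
    have ht : m.2 = m'.2 := (hα _ _ hm).1.symm.trans (hα _ _ hm').1
    have q := (hG.typedGraph.unify (hα _ _ hm).2 ht hu).1
    obtain ⟨h₁, h₂, ⟨ρ', q'⟩, h₃⟩ := ih (hG.unify (hα _ _ hm).2 ht hu) (hα.rename q)
    have hss := hu.ssubset (hα _ _ hm').2 hne
    refine ⟨h₁, h₂, ⟨_, q.comp q'⟩, .inl ?_⟩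
    obtain h₃ | ⟨rfl, -⟩ := h₃
    · exact h₃.trans hss
    · exact hss

/-- P1 unifies different nodes and loses one; their types agree because `α` respects types. P2
leaves the graph alone and extends `α` only where it was undefined, which keeps it functional. -/
theorem Rule.spec {Gq : RPTG V T F} {r r' : RPTG V T F × Alpha V T} (h : Rule Gq r r')
    (hq : P.TypedGraph q Gq) (hG : P.Good p r.1) (hα : r.2.Typed r.1) :
    P.Good p r'.1 ∧ r'.2.Typed r'.1 ∧ (∃ ρ, r.1.IsQuot ρ r'.1) ∧ (r'.1.nodes ⊂ r.1.nodes ∨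
      r'.1 = r.1 ∧ r.2 ⊆ r'.2 ∧ (r.2.Functional → r'.2.Functional)) := by
  cases h with
  | P1 G G' α nq mq np mp mp' l ρ he hn hp hm hne hu =>
    have hmp := hG.typedGraph.tgt hp
    have ht : mp.2 = mp'.2 :=
      (hG.typedGraph.same_type hq hp he (hα _ _ hn).1.symm).trans (hα _ _ hm).1
    have q := (hG.typedGraph.unify hmp ht hu).1
    exact ⟨hG.unify hmp ht hu, hα.rename q, ⟨ρ, q⟩, .inl (hu.ssubset (hα _ _ hm).2 hne.symm)⟩
  | P2 G α nq mq np mp l he hn hp hm =>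
    refine ⟨hG, ?_, ⟨id, .refl _⟩, .inr ⟨rfl, Set.subset_insert _ _, fun hf => ?_⟩⟩
    · rintro n m (h | h)
      · simp only [Prod.mk.injEq] at h
        obtain ⟨rfl, rfl⟩ := h
        exact ⟨(hG.typedGraph.same_type hq hp he (hα _ _ hn).1.symm).symm, hG.typedGraph.tgt hp⟩
      · exact hα _ _ h
    · rintro n m m' (h | h) (h' | h')
      · simp only [Prod.mk.injEq] at h h'
        rw [h.2, h'.2]
      · simp only [Prod.mk.injEq] at h
        exact absurd (h.1 ▸ h') (hm _)
      · simp only [Prod.mk.injEq] at h'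
        exact absurd (h'.1 ▸ h) (hm _)
      · exact hf _ _ _ h h'

theorem Rule.spec_reflTransGen {Gq : RPTG V T F} {r r' : RPTG V T F × Alpha V T}
    (h : Relation.ReflTransGen (Rule Gq) r r') (hq : P.TypedGraph q Gq) (hG : P.Good p r.1)
    (hα : r.2.Typed r.1) :
    P.Good p r'.1 ∧ r'.2.Typed r'.1 ∧ (∃ ρ, r.1.IsQuot ρ r'.1) ∧ (r'.1.nodes ⊂ r.1.nodes ∨
      r'.1 = r.1 ∧ r.2 ⊆ r'.2 ∧ (r.2.Functional → r'.2.Functional)) := by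
  induction h with
  | refl => exact ⟨hG, hα, ⟨id, .refl _⟩, .inr ⟨rfl, subset_rfl, id⟩⟩
  | tail _ h ih =>
    obtain ⟨h₁, h₂, ⟨ρ, q₁⟩, h₃⟩ := ih
    obtain ⟨h₁', h₂', ⟨ρ', q'⟩, h₃'⟩ := h.spec hq h₁ h₂
    refine ⟨h₁', h₂', ⟨_, q₁.comp q'⟩, ?_⟩
    obtain h₃ | ⟨e, hs, hf⟩ := h₃ <;> obtain h₃' | ⟨e', hs', hf'⟩ := h₃'
    · exact .inl (h₃'.trans h₃)
    · exact .inl (e' ▸ h₃)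
    · exact .inl (e ▸ h₃')
    · exact .inr ⟨e'.trans e, hs.trans hs', hf' ∘ hf⟩

open Classical in
/-- A functional `α` that is closed under the rules provides a map as required. -/
theorem exists_isCallMap {Gq Gp : RPTG V T F} {xs ys : List V} {α : Alpha V T}
    (hq : P.TypedGraph q Gq) (hp : P.TypedGraph p Gp) (hα : α.Typed Gp) (hf : α.Functional)
    (hi : Alpha.init Gq Gp xs ys ⊆ α) (hc : ¬ Applicable Gq Gp α)
    (hlen : xs.length = ys.length) (hys : ∀ y ∈ ys, y ∈ P.vars p) : ∃ α', IsCallMap Gq Gp xs ys α' := by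
  -- The value outside the domain of `α` is arbitrary: only nodes reachable from formal arguments
  -- matter, and these turn out to lie in the domain.
  let f : Node V T → Node V T := fun n => if h : ∃ m, (n, m) ∈ α then h.choose else n
  have hfα : ∀ {n m}, (n, m) ∈ α → f n = m := by
    intro n m h
    have h' : ∃ m, (n, m) ∈ α := ⟨m, h⟩
    simp only [f, dif_pos h']
    exact hf _ _ _ h'.choose_spec h
  -- As `α` preserves types and the caller's graph has all typed edges, `np` has an edge with the
  -- label `l`. If its target were not related to `m`, then P1 or P2 would be applicable.
  have step : ∀ {n m np l}, (n, l, m) ∈ Gq.edges → (n, np) ∈ α →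
      ∃ mp, (np, l, mp) ∈ Gp.edges ∧ (m, mp) ∈ α := by
    intro n m np l he hn
    obtain ⟨ts, hs, ht⟩ := hq.edge he
    obtain ⟨mp, hmp⟩ := hp.total (hα _ _ hn).2 ((hα _ _ hn).1 ▸ hs) ht
    refine ⟨mp, hmp, ?_⟩
    by_contra hmem
    apply hc
    refine ⟨n, m, np, mp, l, he, hn, hmp, ?_⟩
    by_cases h : ∃ k, (m, k) ∈ α
    · obtain ⟨k, hk⟩ := h
      exact .inl ⟨k, hk, fun h => hmem (h ▸ hk)⟩
    · exact .inr fun k hk => h ⟨k, hk⟩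
  refine ⟨f, fun k x y n m hx hy hn hm => hfα (hi ⟨k, x, y, hx, hy, hn, hm⟩), ?_⟩
  intro x hx n₀ n l m hn₀ hr he
  obtain ⟨k, hk, rfl⟩ := List.mem_iff_getElem.1 hx
  obtain ⟨m₀, hm₀⟩ := hp.loc_exists (hys ys[k] (List.getElem_mem (hlen ▸ hk)))
  have h₀ : (n₀, m₀) ∈ α := hi ⟨k, _, _, List.getElem?_eq_getElem hk, List.getElem?_eq_getElem _, hn₀, hm₀⟩
  have hn : ∃ np, (n, np) ∈ α := by
    clear he
    induction hr with
    | refl => exact ⟨m₀, h₀⟩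
    | tail _ h ih =>
      obtain ⟨l, h⟩ := h
      obtain ⟨np, hnp⟩ := ih
      obtain ⟨mp, -, h⟩ := step h hnp
      exact ⟨mp, h⟩
  obtain ⟨np, hnp⟩ := hn
  obtain ⟨mp, he', hmp⟩ := step he hnp
  rw [hfα hnp, hfα hmp]
  exact he'

theorem Program.WellFormed.formals_length (hP : P.WellFormed) {ys : List V}
    (hc : (q, ys) ∈ (P.body p).calls) : (P.formals q).length = ys.length := by
  simpa using (congrArg List.length (hP.calls_ok p q ys hc).2).symm

theorem Program.WellFormed.arg_type (hP : P.WellFormed) {ys : List V}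
    (hc : (q, ys) ∈ (P.body p).calls) {k : ℕ} {x y : V} (hx : (P.formals q)[k]? = some x)
    (hy : ys[k]? = some y) : P.varType q x = P.varType p y := by
  have := congrArg (·[k]?) (hP.calls_ok p q ys hc).2
  simpa [hx, hy] using this.symm

/-- If the caller's graph comes out unchanged, neither `EnsureFun` nor P1 has unified anything, so
the final `α` extends the initial one and is functional and closed under the rules. -/
theorem CallSite.spec (hP : P.WellFormed) {Gq Gp : RPTG V T F} {ys : List V}
    {r : RPTG V T F × Alpha V T} (hc : (q, ys) ∈ (P.body p).calls)
    (h : CallSite Gq Gp (P.formals q) ys r) (hq : P.Good q Gq) (hp : P.Good p Gp) :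
    P.Good p r.1 ∧ (∃ ρ, Gp.IsQuot ρ r.1) ∧ Gp.Shrinks r.1 ∧
      (r.1 = Gp → ∃ α, IsCallMap Gq Gp (P.formals q) ys α) := by
  obtain ⟨r₁, h₁, h₂, hna⟩ := h
  have hα : (Alpha.init Gq Gp (P.formals q) ys).Typed Gp := by
    rintro n m ⟨k, x, y, hx, hy, hn, hm⟩
    refine ⟨?_, hm.1⟩
    rw [hq.typedGraph.loc_type hn, hp.typedGraph.loc_type hm]
    exact hP.arg_type hc hx hy
  obtain ⟨g₁, t₁, ⟨ρ, q₁⟩, s₁⟩ := h₁.spec hp hα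
  obtain ⟨g₂, t₂, ⟨ρ', q₂⟩, s₂⟩ := Rule.spec_reflTransGen h₂ hq.typedGraph g₁ t₁
  refine ⟨g₂, ⟨_, q₁.comp q₂⟩, ?_⟩
  obtain s₁ | ⟨rfl, f₁⟩ := s₁
  · have hss : r.1.nodes ⊂ Gp.nodes := by
      obtain s₂ | ⟨e, -⟩ := s₂
      · exact s₂.trans s₁
      · exact e ▸ s₁
    exact ⟨.inl hss, fun e => absurd (e ▸ hss) (ssubset_irrefl _)⟩
  · obtain s₂ | ⟨e, hs, f₂⟩ := s₂
    · exact ⟨.inl s₂, fun e => absurd (e ▸ s₂) (ssubset_irrefl _)⟩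
    · refine ⟨.inr e, fun _ => ?_⟩
      simp only at e hs f₂ f₁
      rw [e] at t₂ hna
      exact exists_isCallMap hq.typedGraph hp.typedGraph t₂ (f₂ f₁) hs hna (hP.formals_length hc)
        fun y hy => P.mem_vars_of_call hc hy

/-! ### From a single call site to the whole program. -/

/-- Invariant of the interprocedural analysis. -/
def Program.AllGood (P : Program V T F Pr) (Γ : Pr → RPTG V T F) : Prop :=
  ∀ p, P.Good p (Γ p) ∧ ∀ u ∈ (P.body p).unifs, (Γ p).Satisfies u

/-- The graphs of the callees of `p` have been integrated into the graph of `p`. -/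
def Program.CallsDone (P : Program V T F Pr) (Γ : Pr → RPTG V T F) (p : Pr) : Prop :=
  ∀ q ys, (q, ys) ∈ (P.body p).calls → ∃ α, IsCallMap (Γ q) (Γ p) (P.formals q) ys α

/-- All graphs shrink. -/
def ShrinkAll (Γ Γ' : Pr → RPTG V T F) : Prop := ∀ p, (Γ p).Shrinks (Γ' p)

theorem ShrinkAll.refl (Γ : Pr → RPTG V T F) : ShrinkAll Γ Γ := fun _ => .refl _

theorem ShrinkAll.trans {Γ₁ Γ₂ Γ₃ : Pr → RPTG V T F} (h : ShrinkAll Γ₁ Γ₂) (h' : ShrinkAll Γ₂ Γ₃) :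
    ShrinkAll Γ₁ Γ₃ := fun p => (h p).trans (h' p)

theorem ShrinkAll.antisymm {Γ Γ' : Pr → RPTG V T F} (h : ShrinkAll Γ Γ') (h' : ShrinkAll Γ' Γ) :
    Γ' = Γ := funext fun p => (h p).antisymm (h' p)

/-- `Γ'` results from `Γ` by changes of graphs of procedures in `C` only. -/
structure Program.Refines (P : Program V T F Pr) (C : Set Pr) (Γ Γ' : Pr → RPTG V T F) : Prop where
  good : P.AllGood Γ'
  shrink : ShrinkAll Γ Γ'
  eq_off : ∀ p ∉ C, Γ' p = Γ p

theorem Program.Refines.trans {C : Set Pr} {Γ₁ Γ₂ Γ₃ : Pr → RPTG V T F} (h : P.Refines C Γ₁ Γ₂)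
    (h' : P.Refines C Γ₂ Γ₃) : P.Refines C Γ₁ Γ₃ :=
  ⟨h'.good, h.shrink.trans h'.shrink, fun p hp => (h'.eq_off p hp).trans (h.eq_off p hp)⟩

theorem Program.Refines.mono {C D : Set Pr} {Γ Γ' : Pr → RPTG V T F} (h : P.Refines C Γ Γ')
    (hCD : C ⊆ D) : P.Refines D Γ Γ' :=
  ⟨h.good, h.shrink, fun p hp => h.eq_off p fun h => hp (hCD h)⟩

/-- The callee's graph is a snapshot from the beginning of the processing. For a directly recursive
call the snapshot could become outdated, but not if the step changes no graph, which is the only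
case in which a call map is claimed. -/
theorem Program.ProcessCall.spec (hP : P.WellFormed) {k : ℕ} {s s' : InterState V T F Pr}
    (h : P.ProcessCall p k s s') (hs : P.AllGood s.1) : P.Refines {p} s.1 s'.1 ∧
      (s'.1 = s.1 → ∀ q ys, (P.body p).calls[k]? = some (q, ys) →
        ∃ α, IsCallMap (s.1 q) (s.1 p) (P.formals q) ys α) := by
  classical
  obtain ⟨q, ys, G, α, hk, h, rfl⟩ := h
  obtain ⟨g, ⟨ρ, hq⟩, sh, hα⟩ := h.spec hP (List.mem_of_getElem? hk) (hs q).1 (hs p).1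
  refine ⟨⟨fun p' => ?_, fun p' => ?_, fun p' hp' => ?_⟩, fun e q' ys' hk' => ?_⟩
  · by_cases hp' : p' = p
    · subst hp'
      simp only [Function.update_self]
      exact ⟨g, fun u hu => ((hs _).2 u hu).quot hq⟩
    · simp only [Function.update_of_ne hp']
      exact hs p'
  · by_cases hp' : p' = p
    · subst hp'
      simpa only [Function.update_self] using sh
    · simp only [Function.update_of_ne hp']
      exact .refl _
  · exact Function.update_of_ne hp' _ _
  · obtain ⟨rfl, rfl⟩ : q = q' ∧ ys = ys' := by simpa [hk] using hk'
    exact hα (by simpa only [Function.update_self] using congrFun e p)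

theorem Program.InterPass.spec (hP : P.WellFormed) {s s' : InterState V T F Pr}
    (h : P.InterPass p s s') (hs : P.AllGood s.1) :
    P.Refines {p} s.1 s'.1 ∧ (s'.1 = s.1 → P.CallsDone s.1 p) := by
  obtain ⟨ks, hks, h⟩ := h
  have refines : P.Refines {p} s.1 s'.1 := by
    refine h.invariant (I := fun t => P.Refines {p} s.1 t.1) ?_ ⟨hs, .refl _, fun _ _ => rfl⟩
    intro k _ t t' ht htt'
    exact ht.trans (htt'.spec hP ht.good).1
  refine ⟨refines, fun e q ys hc => ?_⟩
  obtain ⟨k, hk, e'⟩ := List.mem_iff_getElem.1 hc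
  -- Only the graphs are compared; the stored `α` need no order. The pass visits a permutation of
  -- all call sites, so the site `k` was processed in it, starting and ending with the graphs `s.1`.
  obtain ⟨t, t', ht, hstep, e₁, e₂⟩ := (h.constant (I := fun t => P.AllGood t.1) (π := Prod.fst)
    ShrinkAll.refl ShrinkAll.trans ShrinkAll.antisymm
    (fun k _ t t' ht htt' => ⟨(htt'.spec hP ht).1.good, (htt'.spec hP ht).1.shrink⟩) hs).2 e k
    (hks.mem_iff.2 (List.mem_range.2 hk))
  have := (hstep.spec hP ht).2 (e₂.trans e₁.symm) q ys (by rw [List.getElem?_eq_getElem hk, e'])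
  rwa [e₁] at this

theorem Program.Interproc.spec (hP : P.WellFormed) {Γ Γ' : Pr → RPTG V T F} (h : P.Interproc p Γ Γ')
    (hs : P.AllGood Γ) : P.Refines {p} Γ Γ' ∧ P.CallsDone Γ' p := by
  obtain ⟨A, h⟩ := h
  obtain ⟨h₁, h₂⟩ := h.invariant (I := fun t => P.Refines {p} Γ t.1)
    (fun t t' ht htt' => ht.trans (htt'.spec hP ht.good).1) ⟨hs, .refl _, fun _ _ => rfl⟩
  exact ⟨h₁, (h₂.spec hP h₁.good).2 rfl⟩

/-- In the last pass over `C` every run of `Interproc` starts and ends with the final graphs. The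
call maps of all members therefore hold simultaneously, also under mutual recursion. -/
theorem Program.component_spec (hP : P.WellFormed) {C : List Pr} {Γ Γ' : Pr → RPTG V T F}
    (h : RepeatUntilStable (RunList P.Interproc C) Γ Γ') (hs : P.AllGood Γ) :
    P.Refines {p | p ∈ C} Γ Γ' ∧ ∀ p ∈ C, P.CallsDone Γ' p := by
  have pass : ∀ Γ₁ Γ₂, P.AllGood Γ₁ → RunList P.Interproc C Γ₁ Γ₂ → P.Refines {p | p ∈ C} Γ₁ Γ₂ := by
    intro Γ₁ Γ₂ h₁ h
    refine h.invariant (I := fun Δ => P.Refines {p | p ∈ C} Γ₁ Δ) ?_ ⟨h₁, .refl _, fun _ _ => rfl⟩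
    exact fun p hp Δ Δ' hΔ hstep =>
      hΔ.trans ((hstep.spec hP hΔ.good).1.mono (Set.singleton_subset_iff.2 hp))
  obtain ⟨h₁, h₂⟩ := h.invariant (I := fun Δ => P.Refines {p | p ∈ C} Γ Δ)
    (fun Δ Δ' hΔ hstep => hΔ.trans (pass _ _ hΔ.good hstep)) ⟨hs, .refl _, fun _ _ => rfl⟩
  refine ⟨h₁, fun p hp => ?_⟩
  obtain ⟨Δ, Δ', hΔ, hstep, rfl, e⟩ := (h₂.constant (I := P.AllGood) (π := id)
    ShrinkAll.refl ShrinkAll.trans ShrinkAll.antisymm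
    (fun k _ t t' ht htt' => ⟨(htt'.spec hP ht).1.good, (htt'.spec hP ht).1.shrink⟩) h₁.good).2 rfl p hp
  obtain rfl : Δ' = Δ := e
  exact (hstep.spec hP hΔ).2

/-- `D` is the set of finished procedures, closed under callees. Later components change neither
their graphs nor those of their callees, so their call maps persist. `hL` is the bottom-up order,
phrased for prefixes of the list. -/
theorem Program.components_spec (hP : P.WellFormed) {L : List (List Pr)} {Γ Γ' : Pr → RPTG V T F}
    (h : RunList (fun C => RepeatUntilStable (RunList P.Interproc C)) L Γ Γ') (hs : P.AllGood Γ)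
    (hnd : L.flatten.Nodup) {D : Set Pr} (hD : ∀ p ∈ D, p ∉ L.flatten) (hDone : ∀ p ∈ D, P.CallsDone Γ p)
    (hcalls : ∀ p ∈ D, ∀ q, P.Calls p q → q ∈ D)
    (hL : ∀ L₁ C L₂, L = L₁ ++ C :: L₂ → ∀ p ∈ C, ∀ q, P.Calls p q → q ∈ D ∨ q ∈ L₁.flatten ∨ q ∈ C) :
    P.AllGood Γ' ∧ ∀ p, p ∈ D ∨ p ∈ L.flatten → P.CallsDone Γ' p := by
  induction h generalizing D with
  | nil => exact ⟨hs, by simpa using hDone⟩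
  | cons C L Γ Γ₁ Γ₂ h _ ih =>
    obtain ⟨r, hC⟩ := component_spec hP h hs
    rw [List.flatten_cons, List.nodup_append] at hnd
    simp only [List.flatten_cons, List.mem_append, not_or] at hD
    have := ih r.good hnd.2.1 (D := D ∪ {p | p ∈ C}) ?_ ?_ ?_ ?_
    · refine ⟨this.1, fun p hp => this.2 p ?_⟩
      simpa [or_assoc] using hp
    · rintro p (hp | hp) hp'
      · exact (hD p hp).2 hp'
      · exact hnd.2.2 p hp p hp' rfl
    · rintro p (hp | hp)
      · intro q ys hc
        rw [r.eq_off p (hD p hp).1, r.eq_off q (hD q (hcalls p hp q ⟨ys, hc⟩)).1]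
        exact hDone p hp q ys hc
      · exact hC p hp
    · rintro p (hp | hp) q hpq
      · exact .inl (hcalls p hp q hpq)
      · obtain h | h | h := hL [] C L rfl p hp q hpq
        · exact .inl h
        · simp at h
        · exact .inr h
    · rintro L₁ C' L₂ rfl p hp q hpq
      obtain h | h | h := hL (C :: L₁) C' L₂ rfl p hp q hpq
      · exact .inl (.inl h)
      · rw [List.flatten_cons, List.mem_append] at h
        exact h.elim (fun h => .inl (.inr h)) fun h => .inr (.inl h)
      · exact .inr (.inr h)

theorem Program.Analysis.spec (hP : P.WellFormed) {Γ : Pr → RPTG V T F} (h : P.Analysis Γ) :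
    P.AllGood Γ ∧ ∀ p, P.CallsDone Γ p := by
  obtain ⟨Γ₀, L, h₀, hL, h⟩ := h
  have := components_spec hP h (fun p => (h₀ p).spec hP) hL.nodup (D := ∅) (by simp) (by simp) (by simp) ?_
  · exact ⟨this.1, fun p => this.2 p (.inr (hL.complete p))⟩
  · rintro L₁ C L₂ rfl p hp q hpq
    have hq := hL.complete q
    rw [List.flatten_append, List.flatten_cons, List.mem_append, List.mem_append] at hq
    obtain hq | hq | hq := hq
    · exact .inr (.inl hq)
    · exact .inr (.inr hq)
    · obtain ⟨D, hD, hq⟩ := List.mem_flatten.1 hq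
      have := (List.pairwise_cons.1 (List.pairwise_append.1 hL.order).2.1).1 D hD p hp q hq
      exact absurd hpq this

theorem IsCallMap.reach {Gq Gp : RPTG V T F} {xs ys : List V} {α : Node V T → Node V T}
    (h : IsCallMap Gq Gp xs ys α) {x : V} (hx : x ∈ xs) {n₀ n : Node V T} (hn : Gq.Loc x n₀)
    (hr : Gq.Reach n₀ n) : Gp.Reach (α n₀) (α n) := by
  induction hr with
  | refl => exact .refl
  | tail hr he ih =>
    obtain ⟨l, he⟩ := he
    exact ih.tail ⟨l, h.edges x hx _ _ _ _ hn hr he⟩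

theorem IsCallMap.path {Gq Gp : RPTG V T F} {xs ys : List V} {α : Node V T → Node V T}
    (h : IsCallMap Gq Gp xs ys α) {x : V} (hx : x ∈ xs) {n₀ n m : Node V T} {π : List (Label F)}
    (hn₀ : Gq.Loc x n₀) (hr : Gq.Reach n₀ n) (hp : Gq.Path n π m) : Gp.Path (α n) π (α m) := by
  induction π generalizing n with
  | nil => exact congrArg α hp
  | cons l π ih =>
    obtain ⟨k, he, hp⟩ := hp
    exact ⟨α k, h.edges x hx _ _ _ _ hn₀ hr he, ih (hr.tail ⟨l, he⟩) hp⟩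

theorem IsCallMap.nodeAt {Gq Gp : RPTG V T F} {xs ys : List V} {α : Node V T → Node V T}
    (h : IsCallMap Gq Gp xs ys α) {k : ℕ} {x y : V} (hx : xs[k]? = some x) (hy : ys[k]? = some y)
    (hloc : ∃ m, Gp.Loc y m) {π : List (Label F)} {n : Node V T} (hn : Gq.NodeAt x π n) :
    Gp.NodeAt y π (α n) := by
  obtain ⟨n₀, hn₀, hp⟩ := hn
  obtain ⟨m₀, hm₀⟩ := hloc
  refine ⟨m₀, hm₀, ?_⟩
  rw [← h.args k x y n₀ m₀ hx hy hn₀ hm₀]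
  exact h.path (List.mem_of_getElem? hx) hn₀ .refl hp

/-- The call map is a homomorphism on what the formal arguments reach, so it carries a common node
`k` to the common node `α k`. -/
theorem IsCallMap.regionShare {Gq Gp : RPTG V T F} {xs ys : List V} {α : Node V T → Node V T}
    (h : IsCallMap Gq Gp xs ys α) {i j : ℕ} {x x' y y' : V} (hx : xs[i]? = some x)
    (hx' : xs[j]? = some x') (hy : ys[i]? = some y) (hy' : ys[j]? = some y') (hloc : ∃ m, Gp.Loc y m)
    (hloc' : ∃ m, Gp.Loc y' m) (hs : Gq.RegionShare x x') : Gp.RegionShare y y' := by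
  obtain ⟨n, n', k, hn, hn', hr, hr'⟩ := hs
  obtain ⟨m, hm⟩ := hloc
  obtain ⟨m', hm'⟩ := hloc'
  have hr := h.reach (List.mem_of_getElem? hx) hn hr
  have hr' := h.reach (List.mem_of_getElem? hx') hn' hr'
  rw [h.args _ _ _ _ _ hx hy hn hm] at hr
  rw [h.args _ _ _ _ _ hx' hy' hn' hm'] at hr'
  exact ⟨m, m', α k, hm, hm', hr, hr'⟩

end InterSpec

end Mercury

namespace Mercury

/-! ### Execution: the invariant of a single activation. -/

section ExecSpec

variable {V T F Pr : Type*}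

open RPTG

/-! ### Heaps -/

/-- In an activation with bindings `σ`, the subterm at the position `π` of the term bound to `x` is at
address `b`. -/
def Env.SubtermAt (σ : Env V) (h : Heap F) (x : V) (π : List (Label F)) (b : ℕ) : Prop :=
  ∃ a, σ x = some a ∧ HeapPath h a π b

variable {P : Program V T F Pr} {τ : ℕ → T} {h : Heap F}

/-- Pointers lead to strictly smaller addresses. In particular, everything reachable from a cell
below `base` is itself below `base`. -/
theorem HeapPath.le (hh : P.HeapTyping τ h) {a b : ℕ} {π : List (Label F)} (hp : HeapPath h a π b) :
    b ≤ a := by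
  induction π generalizing a with
  | nil => exact hp.ge
  | cons l π ih =>
    obtain ⟨c, a', hc, -, ha', hp⟩ := hp
    exact (ih hp).trans ((hh a c hc).2 a' (List.mem_of_getElem? ha')).le

theorem heapPath_append_iff (hh : P.HeapTyping τ h) (e : Heap F) {a b : ℕ} {π : List (Label F)}
    (ha : a < h.length) : HeapPath (h ++ e) a π b ↔ HeapPath h a π b := by
  induction π generalizing a with
  | nil => rfl
  | cons l π ih =>
    simp only [HeapPath, List.getElem?_append_left ha]
    refine exists_congr fun c => exists_congr fun a' => and_congr_right fun hc =>
      and_congr_right fun _ => and_congr_right fun ha' => ih ?_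
    exact ((hh a c hc).2 a' (List.mem_of_getElem? ha')).trans ha

/-- A typed graph has a node for each subterm. -/
theorem HeapPath.exists_path {p : Pr} {G : RPTG V T F} (hh : P.HeapTyping τ h) (hG : P.TypedGraph p G)
    {a b : ℕ} {π : List (Label F)} (hp : HeapPath h a π b) {n : Node V T} (hn : n ∈ G.nodes)
    (ht : n.2 = τ a) : ∃ m, G.Path n π m ∧ m.2 = τ b := by
  induction π generalizing a n with
  | nil => exact ⟨n, rfl, by rw [ht, show a = b from hp]⟩
  | cons l π ih =>
    obtain ⟨c, a', hc, hf, ha', hp⟩ := hp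
    have hs : P.sig n.2 l.1 = some (c.args.map τ) := by rw [ht, ← hf]; exact (hh a c hc).1
    have hi : (c.args.map τ)[l.2]? = some (τ a') := by simp [ha']
    obtain ⟨k, he⟩ := hG.total hn hs hi
    obtain ⟨m, hm, hmt⟩ := ih hp (hG.tgt he) (hG.tgt_type he hs hi)
    exact ⟨m, ⟨k, he, hm⟩, hmt⟩

theorem Program.HeapTyping.append_cell (hh : P.HeapTyping τ h) {t : T} {f : F} {as : List ℕ}
    (hs : P.sig t f = some (as.map τ)) (has : ∀ a ∈ as, a < h.length) :
    P.HeapTyping (Function.update τ h.length t) (h ++ [⟨f, as⟩]) := by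
  have map : ∀ l : List ℕ, (∀ a ∈ l, a < h.length) → l.map (Function.update τ h.length t) = l.map τ :=
    fun l hl => List.map_congr_left fun a ha => Function.update_of_ne (hl a ha).ne _ _
  intro a c hc
  obtain ha | ha := lt_or_ge a h.length
  · rw [List.getElem?_append_left ha] at hc
    obtain ⟨h₁, h₂⟩ := hh a c hc
    rw [map _ fun a' ha' => (h₂ a' ha').trans ha, Function.update_of_ne ha.ne]
    exact ⟨h₁, h₂⟩
  · rw [List.getElem?_append_right ha] at hc
    obtain ⟨h₁, h₂⟩ := List.getElem?_eq_some_iff.1 hc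
    obtain rfl : a = h.length := by simp at h₁; omega
    simp only [Nat.sub_self, List.getElem_cons_zero] at h₂
    subst h₂
    rw [map _ has, Function.update_self]
    exact ⟨hs, has⟩

/-! ### Bindings -/

theorem Env.bindAll_eq_some {σ : Env V} {ys : List V} {as : List ℕ} {y : V} {a : ℕ}
    (h : σ.bindAll ys as y = some a) : σ y = some a ∨ ∃ i : ℕ, ys[i]? = some y ∧ as[i]? = some a := by
  induction ys generalizing as with
  | nil => exact .inl h
  | cons z ys ih =>
    cases as with
    | nil => exact .inl h
    | cons b as =>
      simp only [Env.bindAll, Function.update_apply] at h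
      split_ifs at h with hyz
      · exact .inr ⟨0, by simp [hyz], by simpa using h⟩
      · obtain h | ⟨i, hi⟩ := ih h
        · exact .inl h
        · exact .inr ⟨i + 1, by simpa using hi⟩

theorem Env.bindAll_of_bound {σ : Env V} {ys : List V} {as : List ℕ} (hys : ∀ y ∈ ys, σ y = none) {y : V}
    {a : ℕ} (h : σ y = some a) : σ.bindAll ys as y = some a := by
  classical
  induction ys generalizing as with
  | nil => exact h
  | cons z ys ih =>
    cases as with
    | nil => exact h
    | cons b as =>
      have hyz : y ≠ z := by
        rintro rfl
        simp [hys y List.mem_cons_self] at h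
      simp only [Env.bindAll, Function.update_of_ne hyz]
      exact ih fun y hy => hys y (List.mem_cons_of_mem _ hy)

theorem enterEnv_eq_some {σ : Env V} {hs : List (V × Mode)} {ys : List V} {x : V} {a : ℕ}
    (h : enterEnv σ hs ys x = some a) :
    ∃ (k : ℕ) (y : V), hs[k]? = some (x, .input) ∧ ys[k]? = some y ∧ σ y = some a := by
  induction hs generalizing ys with
  | nil => simp [enterEnv] at h
  | cons xm hs ih =>
    obtain ⟨x', m⟩ := xm
    cases ys with
    | nil => cases m <;> simp [enterEnv] at h
    | cons y ys =>
      have shift : enterEnv σ hs ys x = some a → ∃ (k : ℕ) (y' : V),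
          ((x', m) :: hs)[k]? = some (x, .input) ∧ (y :: ys)[k]? = some y' ∧ σ y' = some a := by
        intro h
        obtain ⟨k, y', hk⟩ := ih h
        exact ⟨k + 1, y', by simpa using hk⟩
      cases m with
      | input =>
        simp only [enterEnv, Function.update_apply] at h
        split_ifs at h with hx
        · exact ⟨0, y, by simp [hx], by simp, h⟩
        · exact shift h
      | output => exact shift h

theorem enterEnv_apply {σ : Env V} {hs : List (V × Mode)} {ys : List V} (hnd : (hs.map Prod.fst).Nodup)
    {k : ℕ} {x y : V} (hx : hs[k]? = some (x, .input)) (hy : ys[k]? = some y) :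
    enterEnv σ hs ys x = σ y := by
  classical
  induction hs generalizing ys k with
  | nil => simp at hx
  | cons xm hs ih =>
    obtain ⟨x', m⟩ := xm
    rw [List.map_cons, List.nodup_cons] at hnd
    cases ys with
    | nil => simp at hy
    | cons y' ys =>
      cases k with
      | zero =>
        simp only [List.getElem?_cons_zero, Option.some.injEq, Prod.mk.injEq] at hx hy
        obtain ⟨rfl, rfl⟩ := hx
        subst hy
        simp [enterEnv]
      | succ k =>
        simp only [List.getElem?_cons_succ] at hx hy
        have hne : x ≠ x' := by
          rintro rfl
          exact hnd.1 (List.mem_map.2 ⟨_, List.mem_of_getElem? hx, rfl⟩)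
        cases m with
        | input =>
          simp only [enterEnv, Function.update_of_ne hne]
          exact ih hnd.2 hx hy
        | output => exact ih hnd.2 hx hy

theorem exitEnv_eq_some {σ' σ : Env V} {hs : List (V × Mode)} {ys : List V} {y : V} {a : ℕ}
    (h : exitEnv σ' σ hs ys y = some a) :
    σ y = some a ∨ ∃ (k : ℕ) (x : V), hs[k]? = some (x, .output) ∧ ys[k]? = some y ∧ σ' x = some a := by
  induction hs generalizing ys with
  | nil => exact .inl h
  | cons xm hs ih =>
    obtain ⟨x', m⟩ := xm
    cases ys with
    | nil => cases m <;> exact .inl h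
    | cons y' ys =>
      have shift : exitEnv σ' σ hs ys y = some a → σ y = some a ∨ ∃ (k : ℕ) (x : V),
          ((x', m) :: hs)[k]? = some (x, .output) ∧ (y' :: ys)[k]? = some y ∧ σ' x = some a := by
        intro h
        obtain h | ⟨k, x, hk⟩ := ih h
        · exact .inl h
        · exact .inr ⟨k + 1, x, by simpa using hk⟩
      cases m with
      | output =>
        simp only [exitEnv, Function.update_apply] at h
        split_ifs at h with hy
        · exact .inr ⟨0, x', by simp, by simp [hy], h⟩
        · exact shift h
      | input => exact shift h

/-- The output arguments were free at the call, so the return overwrites nothing. -/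
theorem exitEnv_of_bound {σ' σ : Env V} {hs : List (V × Mode)} {ys : List V} (hm : CallModesOK σ hs ys)
    {y : V} {a : ℕ} (h : σ y = some a) : exitEnv σ' σ hs ys y = some a := by
  classical
  induction hs generalizing ys with
  | nil => exact h
  | cons xm hs ih =>
    obtain ⟨x', m⟩ := xm
    cases ys with
    | nil => cases m <;> exact h
    | cons y' ys =>
      have hm' : CallModesOK σ hs ys := fun x m y hxy =>
        hm x m y (by rw [List.zip_cons_cons]; exact List.mem_cons_of_mem _ hxy)
      cases m with
      | output =>
        have hy : y ≠ y' := by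
          rintro rfl
          have := hm x' .output y (by simp)
          simp [h] at this
        simp only [exitEnv, Function.update_of_ne hy]
        exact ih hm'
      | input => exact ih hm'

/-! ### Activations -/

/-- The bindings of an activation of `p` are well-typed; cells that existed at its start are subterms of input
arguments, in accordance with `G`; cells that have been allocated since have a unique node. -/
structure EnvOK (P : Program V T F Pr) (G : RPTG V T F) (τ : ℕ → T) (h : Heap F) (p : Pr) (σ : Env V)
    (base : ℕ) : Prop where
  typed : ∀ {x a}, σ x = some a → x ∈ P.vars p ∧ a < h.length ∧ τ a = P.varType p x
  old : ∀ {x π b n}, σ.SubtermAt h x π b → G.NodeAt x π n → b < base →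
    ∃ x₀ π₀, (x₀, Mode.input) ∈ P.head p ∧ σ.SubtermAt h x₀ π₀ b ∧ G.NodeAt x₀ π₀ n
  new : ∀ {x π y ρ b n m}, σ.SubtermAt h x π b → σ.SubtermAt h y ρ b → G.NodeAt x π n →
    G.NodeAt y ρ m → base ≤ b → n = m

variable {G : RPTG V T F} {p : Pr} {σ : Env V} {base : ℕ}

theorem EnvOK.exists_nodeAt (hσ : EnvOK P G τ h p σ base) (hG : P.TypedGraph p G)
    (hh : P.HeapTyping τ h) {x : V} {π : List (Label F)} {b : ℕ} (hb : σ.SubtermAt h x π b) :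
    ∃ n, G.NodeAt x π n ∧ n.2 = τ b := by
  obtain ⟨a, hx, hp⟩ := hb
  obtain ⟨hv, -, ht⟩ := hσ.typed hx
  obtain ⟨n, hn⟩ := hG.loc_exists hv
  obtain ⟨m, hm, hmt⟩ := hp.exists_path hh hG hn.1 ((hG.loc_type hn).trans ht.symm)
  exact ⟨m, ⟨n, hn, hm⟩, hmt⟩

/-- Extension of the bindings and of the heap.  Subterms at addresses `≥ B` may be new; others have to be
subterms already. -/
theorem EnvOK.extend (hσ : EnvOK P G τ h p σ base) (hh : P.HeapTyping τ h) {τ' : ℕ → T} (e : Heap F)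
    {σ' : Env V} {B : ℕ} (N : ℕ → Node V T → Prop) (hB : base ≤ B)
    (hlt : ∀ {x a}, σ x = some a → a < B) (hext : ∀ {x a}, σ x = some a → σ' x = some a)
    (htyped : ∀ {x a}, σ' x = some a → x ∈ P.vars p ∧ a < (h ++ e).length ∧ τ' a = P.varType p x)
    (hN : ∀ {b n m}, N b n → N b m → n = m)
    (H : ∀ {x π b n}, σ'.SubtermAt (h ++ e) x π b → G.NodeAt x π n →
      (∃ y ρ, σ.SubtermAt h y ρ b ∧ G.NodeAt y ρ n) ∨ (B ≤ b ∧ N b n)) :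
    EnvOK P G τ' (h ++ e) p σ' base := by
  have ltB : ∀ {x π b}, σ.SubtermAt h x π b → b < B := by
    rintro x π b ⟨a, hx, hp⟩
    exact (hp.le hh).trans_lt (hlt hx)
  refine ⟨htyped, fun hb hn hlt' => ?_, fun hb hb' hn hm hle => ?_⟩
  · obtain ⟨y, ρ, hb, hn⟩ | ⟨hle, -⟩ := H hb hn
    · obtain ⟨x₀, π₀, hin, ⟨a, hx, hp⟩, hn⟩ := hσ.old hb hn hlt'
      exact ⟨x₀, π₀, hin, ⟨a, hext hx, (heapPath_append_iff hh e (hσ.typed hx).2.1).2 hp⟩, hn⟩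
    · omega
  -- The two origins cannot mix: a subterm that was there under `σ` lies below `B`, a new one does
  -- not. Among new ones, `N` allows one node per address.
  · obtain ⟨y, ρ, hb, hn⟩ | ⟨hle₁, hn⟩ := H hb hn <;>
      obtain ⟨y', ρ', hb', hm⟩ | ⟨hle₂, hm⟩ := H hb' hm
    · exact hσ.new hb hb' hn hm hle
    · exact absurd (ltB hb) hle₂.not_gt
    · exact absurd (ltB hb') hle₁.not_gt
    · exact hN hn hm

theorem EnvOK.heap_append (hσ : EnvOK P G τ h p σ base) (hh : P.HeapTyping τ h) (hbase : base ≤ h.length)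
    {τ' : ℕ → T} (hτ : ∀ a < h.length, τ' a = τ a) (e : Heap F) : EnvOK P G τ' (h ++ e) p σ base := by
  refine hσ.extend hh e (fun _ _ => False) hbase (fun hx => (hσ.typed hx).2.1) id (fun hx => ?_)
    (fun h => h.elim) ?_
  · obtain ⟨h₁, h₂, h₃⟩ := hσ.typed hx
    exact ⟨h₁, by simp; omega, by rw [hτ _ h₂, h₃]⟩
  · rintro x π b n ⟨a, hx, hp⟩ hn
    exact .inl ⟨x, π, ⟨a, hx, (heapPath_append_iff hh e (hσ.typed hx).2.1).1 hp⟩, hn⟩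

/-- Extension of the bindings only, without new subterms. -/
theorem EnvOK.bind (hσ : EnvOK P G τ h p σ base) (hh : P.HeapTyping τ h) (hbase : base ≤ h.length)
    {σ' : Env V} (hext : ∀ {x a}, σ x = some a → σ' x = some a)
    (htyped : ∀ {x a}, σ' x = some a → x ∈ P.vars p ∧ a < h.length ∧ τ a = P.varType p x)
    (H : ∀ {x π b n}, σ'.SubtermAt h x π b → G.NodeAt x π n →
      ∃ y ρ, σ.SubtermAt h y ρ b ∧ G.NodeAt y ρ n) :
    EnvOK P G τ h p σ' base := by
  have := hσ.extend (τ' := τ) hh [] (σ' := σ') (fun _ _ => False) hbase (fun hx => (hσ.typed hx).2.1) hext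
    (by simpa using @htyped) (fun h => h.elim) (by simpa using @H)
  simpa using this

theorem UnifSucceeds.extends {u : Unif V F} {σ' : Env V} {h' : Heap F}
    (hu : UnifSucceeds u σ h σ' h') {x : V} {a : ℕ} (hx : σ x = some a) : σ' x = some a := by
  cases hu with
  | assign y z _ _ b hy hz => exact Env.bindAll_of_bound (by simpa using hy) hx
  | construct y f ys _ _ as hy hys => exact Env.bindAll_of_bound (by simpa using hy) hx
  | deconstruct y f ys _ _ b as hy hb hlen hys => exact Env.bindAll_of_bound hys hx
  | test => exact hx

/-- Successful unifications preserve the invariant. -/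
theorem UnifSucceeds.envOK {u : Unif V F} {σ' : Env V} {h' : Heap F} (hu : UnifSucceeds u σ h σ' h')
    (hP : P.WellFormed) (hG : P.Good p G) (hmem : u ∈ (P.body p).unifs) (hsat : G.Satisfies u)
    (hσ : EnvOK P G τ h p σ base) (hh : P.HeapTyping τ h) (hbase : base ≤ h.length) :
    ∃ τ' e, h' = h ++ e ∧ (∀ a < h.length, τ' a = τ a) ∧ P.HeapTyping τ' h' ∧
      EnvOK P G τ' h' p σ' base := by
  have hok := hP.unifs_ok p u hmem
  have hv : ∀ {x}, x ∈ u.vars → x ∈ P.vars p := fun hx => P.mem_vars_of_unif hmem hx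
  have hext := @UnifSucceeds.extends V F h σ u σ' h' hu
  have hGt := hG.typedGraph
  cases hu with
  | assign x y _ _ a hx hy =>
    refine ⟨τ, [], by simp, fun _ _ => rfl, hh, hσ.bind hh hbase hext ?_ ?_⟩
    · intro z b hz
      obtain hz | ⟨i, hz, hb⟩ := Env.bindAll_eq_some hz
      · exact hσ.typed hz
      · obtain ⟨rfl, rfl, rfl⟩ : i = 0 ∧ x = z ∧ a = b := by cases i <;> simp_all
        exact ⟨hv (by simp [Unif.vars]), (hσ.typed hy).2.1, (hσ.typed hy).2.2.trans hok.symm⟩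
    · rintro z π b n ⟨c, hz, hp⟩ hn
      obtain hz | ⟨i, hz, hc⟩ := Env.bindAll_eq_some hz
      · exact ⟨z, π, ⟨c, hz, hp⟩, hn⟩
      · obtain ⟨rfl, rfl, rfl⟩ : i = 0 ∧ x = z ∧ a = c := by cases i <;> simp_all
        -- `x` now has the cell of `y`, and both have the location `k`, so each position of `x` can
        -- be read as the same position of `y`.
        obtain ⟨k, hkx, hky⟩ := hsat
        obtain ⟨k', hk', hpk⟩ := hn
        obtain rfl := hGt.loc_unique hkx hk'
        exact ⟨y, π, ⟨a, hy, hp⟩, k, hky, hpk⟩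
  | construct x f ys _ _ as hx hys =>
    have hlen : ys.length = as.length := by simpa using congrArg List.length hys
    have arg : ∀ {i : ℕ} {b : ℕ}, as[i]? = some b → ∃ y, ys[i]? = some y ∧ σ y = some b := by
      intro i b hb
      have := congrArg (·[i]?) hys
      simp only [List.getElem?_map, hb, Option.map_some] at this
      exact Option.map_eq_some_iff.1 this
    have has : ∀ a ∈ as, a < h.length := by
      intro a ha
      obtain ⟨i, hi⟩ := List.mem_iff_getElem?.1 ha
      obtain ⟨y, -, hy⟩ := arg hi
      exact (hσ.typed hy).2.1
    have hs : P.sig (P.varType p x) f = some (as.map τ) := by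
      rw [hok.2]
      congr 1
      refine List.ext_getElem? fun i => ?_
      simp only [List.getElem?_map]
      obtain hi | hi := lt_or_ge i as.length
      · obtain ⟨y, hy, hyb⟩ := arg (List.getElem?_eq_getElem hi)
        simp [hy, List.getElem?_eq_getElem hi, (hσ.typed hyb).2.2]
      · rw [List.getElem?_eq_none hi, List.getElem?_eq_none (hlen ▸ hi)]
        rfl
    have hτ : ∀ a < h.length, Function.update τ h.length (P.varType p x) a = τ a :=
      fun a ha => Function.update_of_ne ha.ne _ _
    -- The only new subterm is the fresh cell at address `h.length`, at the empty position of `x`;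
    -- hence `B = h.length`, and `N` assigns the location of `x` to it.
    refine ⟨_, _, rfl, hτ, hh.append_cell hs has,
      hσ.extend hh _ (fun b n => b = h.length ∧ G.Loc x n) hbase (fun hz => (hσ.typed hz).2.1) hext ?_
        (fun h₁ h₂ => hGt.loc_unique h₁.2 h₂.2) ?_⟩
    · intro z b hz
      obtain hz | ⟨i, hz, hb⟩ := Env.bindAll_eq_some hz
      · obtain ⟨h₁, h₂, h₃⟩ := hσ.typed hz
        exact ⟨h₁, by simp; omega, by rw [hτ _ h₂, h₃]⟩
      · obtain ⟨rfl, rfl, rfl⟩ : i = 0 ∧ x = z ∧ h.length = b := by cases i <;> simp_all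
        exact ⟨hv (by simp [Unif.vars]), by simp, by simp⟩
    · rintro z π b n ⟨c, hz, hp⟩ hn
      obtain hz | ⟨i, hz, hc⟩ := Env.bindAll_eq_some hz
      · exact .inl ⟨z, π, ⟨c, hz, (heapPath_append_iff hh _ (hσ.typed hz).2.1).1 hp⟩, hn⟩
      · obtain ⟨rfl, rfl, rfl⟩ : i = 0 ∧ x = z ∧ h.length = c := by cases i <;> simp_all
        obtain ⟨k, hk, hpk⟩ := hn
        cases π with
        | nil =>
          obtain rfl : k = n := hpk
          exact .inr ⟨(show h.length = b from hp).le, (show h.length = b from hp).symm, hk⟩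
        | cons l π =>
          obtain ⟨f', j⟩ := l
          obtain ⟨c, a', hc, hf, ha', hp⟩ := hp
          obtain rfl : ⟨f, as⟩ = c := by simpa using hc
          obtain rfl : f = f' := hf
          obtain ⟨y, hy, hyb⟩ := arg ha'
          -- A position `(f, j) :: π` of `x` is the position `π` of the `j`-th argument. By
          -- determinism, the edge followed in the graph is the one to the location of that
          -- argument.
          obtain ⟨k₁, m, hk₁, hm, he⟩ := hsat j y hy
          obtain ⟨m', he', hpk⟩ := hpk
          obtain rfl := hGt.loc_unique hk hk₁
          obtain rfl := hG.det _ _ _ _ he he'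
          exact .inl ⟨y, π, ⟨a', hyb, (heapPath_append_iff hh _ (hσ.typed hyb).2.1).1 hp⟩, m, hm, hpk⟩
  | deconstruct x f ys _ _ a as hx ha hlen hys =>
    have hst : as.map τ = ys.map (P.varType p) := by
      have h₁ := (hh a _ ha).1
      rw [(hσ.typed hx).2.2, hok.2] at h₁
      simpa using h₁.symm
    refine ⟨τ, [], by simp, fun _ _ => rfl, hh, hσ.bind hh hbase hext ?_ ?_⟩
    · intro z b hz
      obtain hz | ⟨i, hz, hb⟩ := Env.bindAll_eq_some hz
      · exact hσ.typed hz
      · refine ⟨hv (by simp [Unif.vars, List.mem_of_getElem? hz]), ?_, ?_⟩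
        · exact ((hh a _ ha).2 b (List.mem_of_getElem? hb)).trans (hσ.typed hx).2.1
        · have := congrArg (·[i]?) hst
          simpa [hz, hb] using this
    · rintro z π b n ⟨c, hz, hp⟩ hn
      obtain hz | ⟨i, hz, hc⟩ := Env.bindAll_eq_some hz
      · exact ⟨z, π, ⟨c, hz, hp⟩, hn⟩
      · obtain ⟨k, m, hk, hm, he⟩ := hsat i z hz
        obtain ⟨m', hm', hpk⟩ := hn
        obtain rfl := hGt.loc_unique hm hm'
        -- Conversely to construction, a position of an extracted argument is a longer position of
        -- `x`, which was already bound.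
        exact ⟨x, (f, i) :: π, ⟨a, hx, _, c, ha, rfl, hc, hp⟩, k, hk, m, he, hpk⟩
  | test x y _ _ a b hx hy hab => exact ⟨τ, [], by simp, fun _ _ => rfl, hh, hσ⟩

/-- At the start of an activation, only input arguments are bound. -/
theorem EnvOK.entry (htyped : ∀ {x a}, σ x = some a →
      (x, Mode.input) ∈ P.head p ∧ a < h.length ∧ τ a = P.varType p x)
    (hh : P.HeapTyping τ h) : EnvOK P G τ h p σ h.length where
  typed hx := by
    obtain ⟨h₁, h₂⟩ := htyped hx
    exact ⟨.inl (List.mem_map.2 ⟨_, h₁, rfl⟩), h₂⟩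
  old := by
    rintro x π b n ⟨a, hx, hp⟩ hn -
    exact ⟨x, π, (htyped hx).1, ⟨a, hx, hp⟩, hn⟩
  -- Vacuous: at entry `base` is the size of the heap, and no reachable address is that large.
  new := by
    rintro x π y ρ b n m ⟨a, hx, hp⟩ - - - hb
    have h₁ := hp.le hh
    have h₂ := (htyped hx).2.1
    omega

theorem Program.formals_getElem? {k : ℕ} {x : V} {m : Mode} (h : (P.head p)[k]? = some (x, m)) :
    (P.formals p)[k]? = some x := by
  simp [Program.formals, h]

/-- The return from a procedure preserves the invariant of the caller. -/
theorem EnvOK.exit (hP : P.WellFormed) {q : Pr} {ys : List V} (hc : (q, ys) ∈ (P.body p).calls)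
    {Gq : RPTG V T F} {α : Node V T → Node V T} (hα : IsCallMap Gq G (P.formals q) ys α)
    (hGq : P.Good q Gq) (hG : P.Good p G) (hh : P.HeapTyping τ h) {σ' : Env V} {base' : ℕ}
    (hσ' : EnvOK P Gq τ h q σ' base') (hσ : EnvOK P G τ h p σ base)
    (hin : ∀ (k : ℕ) x y, (P.head q)[k]? = some (x, Mode.input) → ys[k]? = some y → σ' x = σ y)
    (hm : CallModesOK σ (P.head q) ys) (hle : base ≤ base') (hlt : ∀ {x a}, σ x = some a → a < base') :
    EnvOK P G τ h p (exitEnv σ' σ (P.head q) ys) base := by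
  have hys : ∀ {k y}, ys[k]? = some y → y ∈ P.vars p := fun hy =>
    P.mem_vars_of_call hc (List.mem_of_getElem? hy)
  -- No cell is added at the return itself, but all that the suspended caller could reach lies below
  -- `base'`, the heap size at the call. So the callee's allocations count as new, and `N` gives
  -- them the `α`-image of their node in `Gq`, which is unique by the callee's `new`.
  have := hσ.extend (τ' := τ) hh [] (σ' := exitEnv σ' σ (P.head q) ys) (B := base')
    (fun b n => ∃ x π n', σ'.SubtermAt h x π b ∧ Gq.NodeAt x π n' ∧ α n' = n ∧ base' ≤ b)
    hle hlt (exitEnv_of_bound hm) ?_ ?_ ?_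
  · simpa using this
  · intro y a hy
    rw [List.append_nil]
    obtain hy | ⟨k, x, hx, hy, ha⟩ := exitEnv_eq_some hy
    · exact hσ.typed hy
    · obtain ⟨-, h₁, h₂⟩ := hσ'.typed ha
      exact ⟨hys hy, h₁, h₂.trans (hP.arg_type hc (P.formals_getElem? hx) hy)⟩
  · rintro b n m ⟨x, π, n', hb, hn, rfl, hle⟩ ⟨x', π', m', hb', hm, rfl, -⟩
    rw [hσ'.new hb hb' hn hm hle]
  · rw [List.append_nil]
    rintro y π b n ⟨a, hy, hp⟩ hn
    obtain hy | ⟨k, x, hx, hy, ha⟩ := exitEnv_eq_some hy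
    · exact .inl ⟨y, π, ⟨a, hy, hp⟩, hn⟩
    · have hb : σ'.SubtermAt h x π b := ⟨a, ha, hp⟩
      obtain ⟨n', hn', -⟩ := hσ'.exists_nodeAt hGq.typedGraph hh hb
      have e : α n' = n := hG.nodeAt_unique
        (hα.nodeAt (P.formals_getElem? hx) hy (hG.typedGraph.loc_exists (hys hy)) hn') hn
      obtain hlt' | hle' := lt_or_ge b base'
      -- An older cell handed back through an output also lies below an input `x₀`, with the same
      -- node in `Gq`. The caller's corresponding variable is bound to the same cell as `x₀`, and
      -- its node at `π₀` is the `α`-image of that node.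
      · obtain ⟨x₀, π₀, hx₀, ⟨a₀, ha₀, hp₀⟩, hn₀⟩ := hσ'.old hb hn' hlt'
        obtain ⟨j, hj⟩ := List.mem_iff_getElem?.1 hx₀
        have hj' := P.formals_getElem? hj
        obtain ⟨hjl, -⟩ := List.getElem?_eq_some_iff.1 hj'
        have hy₀ := List.getElem?_eq_getElem (hP.formals_length hc ▸ hjl)
        refine .inl ⟨_, π₀, ⟨a₀, ?_, hp₀⟩, e ▸ hα.nodeAt hj' hy₀ (hG.typedGraph.loc_exists (hys hy₀)) hn₀⟩
        rw [← hin j _ _ hj hy₀, ha₀]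
      · exact .inr ⟨hle', x, π, n', hb, hn', e, hle'⟩

end ExecSpec

end Mercury

namespace Mercury

/-! ### The invariant of the backtracking machine. -/

section Machine

variable {V T F Pr : Type*}

open RPTG

/-- All goals that remain to be executed belong to the body of `p`. -/
def Program.ContOK (P : Program V T F Pr) (p : Pr) (K : List (Instr V F Pr)) : Prop :=
  ∀ g, Instr.goal g ∈ K → g.unifs ⊆ (P.body p).unifs ∧ g.calls ⊆ (P.body p).calls

/-- Invariant for an activation. -/
structure FrameOK (P : Program V T F Pr) (Γ : Pr → RPTG V T F) (τ : ℕ → T) (h : Heap F)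
    (fr : Frame V F Pr) : Prop where
  cont : P.ContOK fr.proc fr.cont
  env : EnvOK P (Γ fr.proc) τ h fr.proc fr.env fr.base
  base_le : fr.base ≤ h.length

/-- Invariant for an activation `fr` and the activation `fr'` that has called it. -/
structure LinkOK (P : Program V T F Pr) (fr fr' : Frame V F Pr) : Prop where
  call : (fr.proc, fr.ret) ∈ (P.body fr'.proc).calls
  input : ∀ (k : ℕ) x y, (P.head fr.proc)[k]? = some (x, Mode.input) → fr.ret[k]? = some y →
    fr.env x = fr'.env y
  modes : CallModesOK fr'.env (P.head fr.proc) fr.ret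
  base_le : fr'.base ≤ fr.base
  env_lt : ∀ {x a}, fr'.env x = some a → a < fr.base

/-- Invariant for a stack of activations together with a heap. -/
def StackOK (P : Program V T F Pr) (Γ : Pr → RPTG V T F) (st : List (Frame V F Pr)) (h : Heap F) : Prop :=
  ∃ τ, P.HeapTyping τ h ∧ (∀ fr ∈ st, FrameOK P Γ τ h fr) ∧ st.IsChain (LinkOK P)

/-- Invariant for choice point stacks. -/
def ChoicesOK (P : Program V T F Pr) (Γ : Pr → RPTG V T F)
    (cps : List (Option (List (Frame V F Pr) × Heap F))) : Prop :=
  ∀ st h, some (st, h) ∈ cps → StackOK P Γ st h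

/-- Invariant of the machine. -/
structure StateOK (P : Program V T F Pr) (Γ : Pr → RPTG V T F) (s : State V F Pr) : Prop where
  stack : StackOK P Γ s.stack s.heap
  choices : ChoicesOK P Γ s.choices

variable {P : Program V T F Pr} {Γ : Pr → RPTG V T F} {h : Heap F}
  {cps : List (Option (List (Frame V F Pr) × Heap F))}

theorem ChoicesOK.mono {cps' : List (Option (List (Frame V F Pr) × Heap F))} (hc : ChoicesOK P Γ cps)
    (hsub : ∀ c, some c ∈ cps' → some c ∈ cps) : ChoicesOK P Γ cps' :=
  fun st h hm => hc st h (hsub _ hm)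

theorem ChoicesOK.cons {st : List (Frame V F Pr)} (hc : ChoicesOK P Γ cps) (hs : StackOK P Γ st h) :
    ChoicesOK P Γ (some (st, h) :: cps) := by
  intro st' h' hm
  obtain hm | hm := List.mem_cons.1 hm
  · simp only [Option.some.injEq, Prod.mk.injEq] at hm
    obtain ⟨rfl, rfl⟩ := hm
    exact hs
  · exact hc _ _ hm

/-- A choice point saves its heap with its stack, and its invariant includes its own heap typing.
Resumption needs nothing from the abandoned computation. -/
theorem Resume.stateOK {s : State V F Pr} (hr : Resume cps s) (hc : ChoicesOK P Γ cps) :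
    StateOK P Γ s := by
  induction hr with
  | here st h cps => exact ⟨hc _ _ List.mem_cons_self, hc.mono fun _ => List.mem_cons_of_mem _⟩
  | skip cps s _ ih => exact ih (hc.mono fun _ => List.mem_cons_of_mem _)

theorem LinkOK.extend {p : Pr} {σ σ' : Env V} {b : ℕ} {K K' : List (Instr V F Pr)} {ret : List V}
    {fr' : Frame V F Pr} (hl : LinkOK P ⟨p, σ, b, K, ret⟩ fr')
    (hext : ∀ {x a}, σ x = some a → σ' x = some a) : LinkOK P ⟨p, σ', b, K', ret⟩ fr' where
  call := hl.call
  modes := hl.modes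
  base_le := hl.base_le
  env_lt := hl.env_lt
  input k x y hx hy := by
    have hmem : ((x, Mode.input), y) ∈ (P.head p).zip ret := by
      refine List.mem_of_getElem? (i := k) ?_
      rw [List.getElem?_zip_eq_some]
      exact ⟨hx, hy⟩
    -- If both sides of the input equation were `none`, a later binding of `x` could break it; the
    -- modes exclude this.
    have hne : fr'.env y ≠ none := hl.modes x .input y hmem
    obtain ⟨a, ha⟩ := Option.ne_none_iff_exists'.1 hne
    rw [ha]
    exact hext ((hl.input k x y hx hy).trans ha)

theorem isChain_extend {p : Pr} {σ σ' : Env V} {b : ℕ} {K K' : List (Instr V F Pr)} {ret : List V}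
    {st : List (Frame V F Pr)} (hl : List.IsChain (LinkOK P) (⟨p, σ, b, K, ret⟩ :: st))
    (hext : ∀ {x a}, σ x = some a → σ' x = some a) :
    List.IsChain (LinkOK P) (⟨p, σ', b, K', ret⟩ :: st) := by
  cases st with
  | nil => exact List.isChain_singleton _
  | cons fr' st =>
    rw [List.isChain_cons_cons] at hl ⊢
    exact ⟨hl.1.extend hext, hl.2⟩

theorem StackOK.cont {p : Pr} {σ : Env V} {b : ℕ} {K K' : List (Instr V F Pr)} {ret : List V}
    {st : List (Frame V F Pr)} (hs : StackOK P Γ (⟨p, σ, b, K, ret⟩ :: st) h)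
    (hK : P.ContOK p K → P.ContOK p K') : StackOK P Γ (⟨p, σ, b, K', ret⟩ :: st) h := by
  obtain ⟨τ, hh, hfr, hl⟩ := hs
  refine ⟨τ, hh, fun fr hm => ?_, isChain_extend hl id⟩
  obtain rfl | hm := List.mem_cons.1 hm
  · obtain ⟨h₁, h₂, h₃⟩ := hfr _ List.mem_cons_self
    exact ⟨hK h₁, h₂, h₃⟩
  · exact hfr fr (List.mem_cons_of_mem _ hm)

theorem StackOK.unif (hP : P.WellFormed) (hΓ : P.AllGood Γ) {u : Unif V F} {p : Pr} {σ σ' : Env V}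
    {b : ℕ} {K : List (Instr V F Pr)} {ret : List V} {st : List (Frame V F Pr)} {h' : Heap F}
    (hs : StackOK P Γ (⟨p, σ, b, .goal (.unif u) :: K, ret⟩ :: st) h) (hu : UnifSucceeds u σ h σ' h') :
    StackOK P Γ (⟨p, σ', b, K, ret⟩ :: st) h' := by
  obtain ⟨τ, hh, hfr, hl⟩ := hs
  obtain ⟨h₁, h₂, h₃⟩ := hfr _ List.mem_cons_self
  have hmem : u ∈ (P.body p).unifs := (h₁ _ List.mem_cons_self).1 (by simp [Goal.unifs])
  obtain ⟨τ', e, rfl, hτ, hh', hσ'⟩ := hu.envOK hP (hΓ p).1 hmem ((hΓ p).2 u hmem) h₂ hh h₃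
  have hlen : ∀ {n}, n ≤ h.length → n ≤ (h ++ e).length := fun hn => hn.trans (by simp)
  refine ⟨τ', hh', fun fr hm => ?_, isChain_extend hl hu.extends⟩
  obtain rfl | hm := List.mem_cons.1 hm
  · exact ⟨fun g hg => h₁ g (List.mem_cons_of_mem _ hg), hσ', hlen h₃⟩
  · obtain ⟨h₁, h₂, h₃⟩ := hfr fr (List.mem_cons_of_mem _ hm)
    -- For the suspended activations only the heap has grown.
    exact ⟨h₁, h₂.heap_append hh h₃ hτ e, hlen h₃⟩

theorem StackOK.call (hP : P.WellFormed) {q p : Pr} {ys : List V} {σ : Env V}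
    {b : ℕ} {K : List (Instr V F Pr)} {ret : List V} {st : List (Frame V F Pr)}
    (hs : StackOK P Γ (⟨p, σ, b, .goal (.call q ys) :: K, ret⟩ :: st) h)
    (hm : CallModesOK σ (P.head q) ys) :
    StackOK P Γ (⟨q, enterEnv σ (P.head q) ys, h.length, [.goal (P.body q)], ys⟩ ::
      ⟨p, σ, b, K, ret⟩ :: st) h := by
  have hs' := hs.cont (K' := K) fun hK g hg => hK g (List.mem_cons_of_mem _ hg)
  obtain ⟨τ, hh, hfr, hl⟩ := hs
  obtain ⟨h₁, h₂, h₃⟩ := hfr _ List.mem_cons_self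
  have hc : (q, ys) ∈ (P.body p).calls := (h₁ _ List.mem_cons_self).2 (by simp [Goal.calls])
  have hnd : ((P.head q).map Prod.fst).Nodup := hP.formals_nodup q
  refine ⟨τ, hh, fun fr hfr' => ?_, List.isChain_cons_cons.2 ⟨?_, isChain_extend hl id⟩⟩
  · obtain rfl | hfr' := List.mem_cons.1 hfr'
    · refine ⟨fun g hg => ?_, EnvOK.entry ?_ hh, le_rfl⟩
      · simp only [List.mem_singleton, Instr.goal.injEq] at hg
        exact hg ▸ ⟨List.Subset.refl _, List.Subset.refl _⟩
      · intro x a hx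
        obtain ⟨k, y, hk, hy, ha⟩ := enterEnv_eq_some hx
        obtain ⟨-, hlt, ht⟩ := h₂.typed ha
        exact ⟨List.mem_of_getElem? hk, hlt,
          ht.trans (hP.arg_type hc (P.formals_getElem? hk) hy).symm⟩
    · obtain rfl | hfr' := List.mem_cons.1 hfr'
      · exact ⟨fun g hg => h₁ g (List.mem_cons_of_mem _ hg), h₂, h₃⟩
      · exact hfr fr (List.mem_cons_of_mem _ hfr')
  · exact ⟨hc, fun k x y hx hy => enterEnv_apply hnd hx hy, hm, h₃, fun hx => (h₂.typed hx).2.1⟩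

theorem StackOK.exit (hP : P.WellFormed) (hΓ : P.AllGood Γ) (hcalls : ∀ p, P.CallsDone Γ p)
    {q p : Pr} {σ' σ : Env V} {b' b : ℕ} {ys ret : List V} {K : List (Instr V F Pr)}
    {st : List (Frame V F Pr)}
    (hs : StackOK P Γ (⟨q, σ', b', [], ys⟩ :: ⟨p, σ, b, K, ret⟩ :: st) h) :
    StackOK P Γ (⟨p, exitEnv σ' σ (P.head q) ys, b, K, ret⟩ :: st) h := by
  obtain ⟨τ, hh, hfr, hl⟩ := hs
  obtain ⟨hlink, hl⟩ := List.isChain_cons_cons.1 hl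
  have hq := hfr _ List.mem_cons_self
  obtain ⟨h₁, h₂, h₃⟩ := hfr _ (List.mem_cons_of_mem _ List.mem_cons_self)
  obtain ⟨α, hα⟩ := hcalls p q ys hlink.call
  refine ⟨τ, hh, fun fr hm => ?_, isChain_extend hl (exitEnv_of_bound hlink.modes)⟩
  obtain rfl | hm := List.mem_cons.1 hm
  · exact ⟨h₁, EnvOK.exit hP hlink.call hα (hΓ q).1 (hΓ p).1 hh hq.env h₂ hlink.input hlink.modes
      hlink.base_le hlink.env_lt, h₃⟩
  · exact hfr fr (List.mem_cons_of_mem _ (List.mem_cons_of_mem _ hm))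

/-- Control transitions only rearrange subgoals of the body and save, resume, disable or drop choice
points. The content lies in `unif`, `call` and `exit`. -/
theorem Program.Step.stateOK (hP : P.WellFormed) (hΓ : P.AllGood Γ) (hcalls : ∀ p, P.CallsDone Γ p)
    {s s' : State V F Pr} (hstep : P.Step s s') (hs : StateOK P Γ s) : StateOK P Γ s' := by
  obtain ⟨hst, hch⟩ := hs
  have tail : ∀ {p : Pr} {i : Instr V F Pr} {K}, P.ContOK p (i :: K) → P.ContOK p K :=
    fun hK g hg => hK g (List.mem_cons_of_mem _ hg)
  have head : ∀ {p : Pr} {i : Instr V F Pr} {K K'}, P.ContOK p (i :: K) →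
      (∀ g, Instr.goal g ∈ K' → Instr.goal g ∈ K ∨
        ∃ g', i = .goal g' ∧ g.unifs ⊆ g'.unifs ∧ g.calls ⊆ g'.calls) → P.ContOK p K' := by
    intro p i K K' hK hsub g hg
    obtain hg | ⟨g', rfl, h₁, h₂⟩ := hsub g hg
    · exact hK g (List.mem_cons_of_mem _ hg)
    · obtain ⟨h₁', h₂'⟩ := hK g' List.mem_cons_self
      exact ⟨List.Subset.trans h₁ h₁', List.Subset.trans h₂ h₂'⟩
  cases hstep with
  | unif u p σ σ' b K ret st h h' cps hu => exact ⟨hst.unif hP hΓ hu, hch⟩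
  | unifFail u p σ b K ret st h cps s hu hr => exact hr.stateOK hch
  | succeed p σ b K ret st h cps => exact ⟨hst.cont tail, hch⟩
  | fail p σ b K ret st h cps s hr => exact hr.stateOK hch
  | conj g₁ g₂ p σ b K ret st h cps =>
    refine ⟨hst.cont fun hK => head hK ?_, hch⟩
    simp only [List.mem_cons, Instr.goal.injEq]
    rintro g (rfl | rfl | hg)
    · exact .inr ⟨_, rfl, by simp [Goal.unifs, Goal.calls]⟩
    · exact .inr ⟨_, rfl, by simp [Goal.unifs, Goal.calls]⟩
    · exact .inl hg
  | disj g₁ g₂ p σ b K ret st h cps =>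
    refine ⟨hst.cont fun hK => head hK ?_, hch.cons (hst.cont fun hK => head hK ?_)⟩ <;>
      simp only [List.mem_cons, Instr.goal.injEq] <;> rintro g (rfl | hg)
    · exact .inr ⟨_, rfl, by simp [Goal.unifs, Goal.calls]⟩
    · exact .inl hg
    · exact .inr ⟨_, rfl, by simp [Goal.unifs, Goal.calls]⟩
    · exact .inl hg
  | ite c t e p σ b K ret st h cps =>
    refine ⟨hst.cont fun hK => head hK ?_, hch.cons (hst.cont fun hK => head hK ?_)⟩ <;>
      simp only [List.mem_cons, Instr.goal.injEq, reduceCtorEq, false_or]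
    · rintro g (rfl | rfl | hg)
      · exact .inr ⟨_, rfl, by simp [Goal.unifs, Goal.calls]⟩
      · exact .inr ⟨_, rfl, by simp [Goal.unifs, Goal.calls]⟩
      · exact .inl hg
    · rintro g (rfl | hg)
      · exact .inr ⟨_, rfl, by simp [Goal.unifs, Goal.calls]⟩
      · exact .inl hg
  | endCond d p σ b K ret st h cps =>
    refine ⟨hst.cont tail, hch.mono fun c hc => ?_⟩
    obtain hc | hc := List.mem_or_eq_of_mem_set hc
    · exact hc
    · cases hc
  | quant xs g p σ b K ret st h cps =>
    refine ⟨hst.cont fun hK => head hK ?_, hch⟩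
    simp only [List.mem_cons, Instr.goal.injEq]
    rintro g (rfl | hg)
    · exact .inr ⟨_, rfl, by simp [Goal.unifs, Goal.calls]⟩
    · exact .inl hg
  | commit xs g p σ b K ret st h cps =>
    refine ⟨hst.cont fun hK => head hK ?_, hch⟩
    simp only [List.mem_cons, Instr.goal.injEq, reduceCtorEq, false_or]
    rintro g (rfl | hg)
    · exact .inr ⟨_, rfl, by simp [Goal.unifs, Goal.calls]⟩
    · exact .inl hg
  | endCommit d p σ b K ret st h cps =>
    exact ⟨hst.cont tail, hch.mono fun c hc => List.mem_of_mem_drop hc⟩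
  | call q ys p σ b K ret st h cps hm => exact ⟨hst.call hP hm, hch⟩
  | exit q σ' b' ys p σ b K ret st h cps hm => exact ⟨hst.exit hP hΓ hcalls, hch⟩

theorem Program.Initial.stateOK {s : State V F Pr} (hs : P.Initial s) : StateOK P Γ s := by
  obtain ⟨p, σ, h, τ, rfl, hh, hin, hout⟩ := hs
  refine ⟨⟨τ, hh, fun fr hm => ?_, List.isChain_singleton _⟩, fun st h hm => by simp at hm⟩
  obtain rfl := List.mem_singleton.1 hm
  refine ⟨fun g hg => ?_, EnvOK.entry ?_ hh, le_rfl⟩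
  · simp only [List.mem_singleton, Instr.goal.injEq] at hg
    exact hg ▸ ⟨List.Subset.refl _, List.Subset.refl _⟩
  · intro x a hx
    by_cases hmem : (x, Mode.input) ∈ P.head p
    · obtain ⟨a', ha', hlt, ht⟩ := hin x hmem
      obtain rfl : a' = a := by simpa [ha'] using hx
      exact ⟨hmem, hlt, ht⟩
    · simp [hout x hmem] at hx

theorem Program.Reachable.stateOK (hP : P.WellFormed) (hΓ : P.AllGood Γ)
    (hcalls : ∀ p, P.CallsDone Γ p) {s : State V F Pr} (hs : P.Reachable s) : StateOK P Γ s := by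
  obtain ⟨s₀, h₀, hr⟩ := hs
  induction hr with
  | refl => exact h₀.stateOK
  | tail _ h ih => exact h.stateOK hP hΓ hcalls ih

/-- Subterms that are the same cell have the same node, or are subterms of different input arguments. -/
theorem EnvOK.sharing {G : RPTG V T F} {τ : ℕ → T} {p : Pr} {σ : Env V} {base : ℕ}
    (hσ : EnvOK P G τ h p σ base) (hG : P.Good p G) (hh : P.HeapTyping τ h) {x y : V}
    {π ρ : List (Label F)} {b : ℕ} {n m : Node V T} (hx : σ.SubtermAt h x π b)
    (hy : σ.SubtermAt h y ρ b) (hn : G.NodeAt x π n) (hm : G.NodeAt y ρ m) :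
    n = m ∨ (b < base ∧ ∃ x₀ y₀ π₀ ρ₀, x₀ ≠ y₀ ∧ (x₀, Mode.input) ∈ P.head p ∧
      (y₀, Mode.input) ∈ P.head p ∧ σ.SubtermAt h x₀ π₀ b ∧ σ.SubtermAt h y₀ ρ₀ b ∧
      G.NodeAt x₀ π₀ n ∧ G.NodeAt y₀ ρ₀ m) := by
  obtain hb | hb := lt_or_ge b base
  · obtain ⟨x₀, π₀, hx₀, hbx, hnx⟩ := hσ.old hx hn hb
    obtain ⟨y₀, ρ₀, hy₀, hby, hmy⟩ := hσ.old hy hm hb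
    -- If both occurrences are traced to the same input argument, both nodes have the type of the
    -- cell, and from one variable only one node of that type can be reached.
    by_cases e : x₀ = y₀
    · subst e
      obtain ⟨n', hn', htn⟩ := hσ.exists_nodeAt hG.typedGraph hh hbx
      obtain ⟨m', hm', htm⟩ := hσ.exists_nodeAt hG.typedGraph hh hby
      obtain rfl := hG.nodeAt_unique hnx hn'
      obtain rfl := hG.nodeAt_unique hmy hm'
      exact .inl (hG.nodeAt_unique_of_type hnx hmy (htn.trans htm.symm))
    · exact .inr ⟨hb, x₀, y₀, π₀, ρ₀, e, hx₀, hy₀, hbx, hby, hnx, hmy⟩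
  · exact .inl (hσ.new hx hy hn hm hb)

end Machine

end Mercury

/-! ### The main theorem. -/

open Mercury in
theorem mainTheorem2 {V T F Pr : Type*} (P : Program V T F Pr) (hP : P.WellFormed)
    (Γ : Pr → RPTG V T F) (hΓ : P.Analysis Γ) :
    -- every variable of a procedure has exactly one location, and `node(n, (f, i))` is unambiguous
    (∀ p, (∀ x ∈ P.vars p, ∃! n, (Γ p).Loc x n) ∧
      ∀ n l m m', (n, l, m) ∈ (Γ p).edges → (n, l, m') ∈ (Γ p).edges → m = m') ∧
    -- sharing created by explicit unifications
    (∀ p x y, Unif.assign x y ∈ (P.body p).unifs → ∃ n, (Γ p).Loc x n ∧ (Γ p).Loc y n) ∧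
    (∀ p x f ys, (Unif.construct x f ys ∈ (P.body p).unifs ∨ Unif.deconstruct x f ys ∈ (P.body p).unifs) →
      ∀ (i : ℕ) y, ys[i]? = some y →
        ∃ n m, (Γ p).Loc x n ∧ (Γ p).Loc y m ∧ (n, (f, i), m) ∈ (Γ p).edges) ∧
    -- sharing created by procedure calls, recursive ones included
    (∀ p q ys, (q, ys) ∈ (P.body p).calls →
      (∃ α : Node V T → Node V T,
        (∀ (k : ℕ) x y n m, (P.formals q)[k]? = some x → ys[k]? = some y →
          (Γ q).Loc x n → (Γ p).Loc y m → α n = m) ∧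
        (∀ x ∈ P.formals q, ∀ n₀ n l m, (Γ q).Loc x n₀ → (Γ q).Reach n₀ n → (n, l, m) ∈ (Γ q).edges →
          (α n, l, α m) ∈ (Γ p).edges)) ∧
      (∀ (i j : ℕ) x x' y y', (P.formals q)[i]? = some x → (P.formals q)[j]? = some x' →
        ys[i]? = some y → ys[j]? = some y' → (Γ q).RegionShare x x' → (Γ p).RegionShare y y')) ∧
    -- at each moment of each execution, in each activation
    (∀ s, P.Reachable s → ∀ fr ∈ s.stack,
      -- locations: each subterm of the term bound to a variable has exactly one node
      (∀ x π b, fr.SubtermAt s.heap x π b → ∃! n, (Γ fr.proc).NodeAt x π n) ∧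
      -- sharing: subterms that are the same cell have the same node, unless the cell existed before the
      -- call and the sharing is already present between two different input arguments
      (∀ x π y ρ b n m, fr.SubtermAt s.heap x π b → fr.SubtermAt s.heap y ρ b →
        (Γ fr.proc).NodeAt x π n → (Γ fr.proc).NodeAt y ρ m →
        n = m ∨ (b < fr.base ∧ ∃ x₀ y₀ π₀ ρ₀, x₀ ≠ y₀ ∧
          (x₀, Mode.input) ∈ P.head fr.proc ∧ (y₀, Mode.input) ∈ P.head fr.proc ∧
          fr.SubtermAt s.heap x₀ π₀ b ∧ fr.SubtermAt s.heap y₀ ρ₀ b ∧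
          (Γ fr.proc).NodeAt x₀ π₀ n ∧ (Γ fr.proc).NodeAt y₀ ρ₀ m)) ∧
      -- hence variables whose terms share a cell region-share
      (∀ x π y ρ b, fr.SubtermAt s.heap x π b → fr.SubtermAt s.heap y ρ b →
        (Γ fr.proc).RegionShare x y ∨ (b < fr.base ∧ ∃ x₀ y₀ π₀ ρ₀, x₀ ≠ y₀ ∧
          (x₀, Mode.input) ∈ P.head fr.proc ∧ (y₀, Mode.input) ∈ P.head fr.proc ∧
          fr.SubtermAt s.heap x₀ π₀ b ∧ fr.SubtermAt s.heap y₀ ρ₀ b ∧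
          (Γ fr.proc).RegionShare x x₀ ∧ (Γ fr.proc).RegionShare y y₀))) ∧
    -- the input arguments of an activation are bound to the cells of the caller's actual arguments
    (∀ s, P.Reachable s → ∀ st₁ fr fr' st₂, s.stack = st₁ ++ fr :: fr' :: st₂ →
      (fr.proc, fr.ret) ∈ (P.body fr'.proc).calls ∧
      ∀ (k : ℕ) x y, (P.head fr.proc)[k]? = some (x, Mode.input) → fr.ret[k]? = some y →
        fr.env x = fr'.env y) := by
  obtain ⟨hG, hC⟩ := hΓ.spec hP
  have loc : ∀ {p x}, x ∈ P.vars p → ∃ n, (Γ p).Loc x n := fun hx => (hG _).1.typedGraph.loc_exists hx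
  refine ⟨fun p => ⟨fun x hx => ?_, (hG p).1.det⟩, fun p x y hu => (hG p).2 _ hu,
    fun p x f ys hu => hu.elim (fun hu => (hG p).2 _ hu) fun hu => (hG p).2 _ hu,
    fun p q ys hc => ?_, fun s hs fr hfr => ?_, fun s hs st₁ fr fr' st₂ e => ?_⟩
  · obtain ⟨n, hn⟩ := loc hx
    exact ⟨n, hn, fun m hm => (hG p).1.typedGraph.loc_unique hm hn⟩
  · obtain ⟨α, hα⟩ := hC p q ys hc
    refine ⟨⟨α, hα.args, hα.edges⟩, fun i j x x' y y' hx hx' hy hy' => ?_⟩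
    exact hα.regionShare hx hx' hy hy' (loc (P.mem_vars_of_call hc (List.mem_of_getElem? hy)))
      (loc (P.mem_vars_of_call hc (List.mem_of_getElem? hy')))
  · obtain ⟨τ, hh, hfrs, -⟩ := (hs.stateOK hP hG hC).stack
    have hσ := (hfrs fr hfr).env
    have hg := (hG fr.proc).1
    have node : ∀ {x π b}, fr.SubtermAt s.heap x π b → ∃ n, (Γ fr.proc).NodeAt x π n := fun hb =>
      let ⟨n, hn, _⟩ := hσ.exists_nodeAt hg.typedGraph hh hb
      ⟨n, hn⟩
    refine ⟨fun x π b hb => ?_, fun x π y ρ b n m hx hy hn hm => hσ.sharing hg hh hx hy hn hm,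
      fun x π y ρ b hx hy => ?_⟩
    · obtain ⟨n, hn⟩ := node hb
      exact ⟨n, hn, fun m hm => hg.nodeAt_unique hm hn⟩
    · obtain ⟨n, hn⟩ := node hx
      obtain ⟨m, hm⟩ := node hy
      obtain rfl | ⟨hb, x₀, y₀, π₀, ρ₀, hne, hx₀, hy₀, hbx, hby, hnx, hmy⟩ :=
        hσ.sharing hg hh hx hy hn hm
      · exact .inl (hn.regionShare hm)
      · exact .inr ⟨hb, x₀, y₀, π₀, ρ₀, hne, hx₀, hy₀, hbx, hby, hn.regionShare hnx,
          hm.regionShare hmy⟩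
  · obtain ⟨τ, -, -, hl⟩ := (hs.stateOK hP hG hC).stack
    rw [e] at hl
    have hlink := (List.isChain_cons_cons.1 (List.isChain_append.1 hl).2.1).1
    exact ⟨hlink.call, hlink.input⟩
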